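/- Let $a$ and $d$ be positive integers and let $\mathscr T_1,\dots,\mathscr T_d$ be locally finite, leafless, rooted directed trees, each of finite branching index (the depths of the vertices with at least two children are bounded); $\mathscr T_j$ has vertex set $V_j$, root $\mathsf{root}_j$ and depth function $\mathsf d$. Put $V=V_1\times\cdots\times V_d$ and, for $v\in V$, $\mathsf d_v=(\mathsf d_{v_1},\dots,\mathsf d_{v_d})\in\mathbb N^d$. Let $\mathsf{Chi}_j(v)$ be the set of $w\in V$ such that $w_j$ is a child of $v_j$ and $w_i=v_i$ for $i\neq j$. Let $S=(S_1,\dots,S_d)$ be the tuple of bounded operators on $\ell^2(V)$ given by $$S_j e_v=\sum_{w\in\mathsf{Chi}_j(v)}\lambda_j(w)e_w,\qquad \lambda_j(w)=\sqrt{\frac{\mathfrak c_a(|\mathsf d_v|)}{\operatorname{card}\mathsf{Chi}_j(v)}}\sqrt{\frac{\mathsf d_{v_j}+1}{|\mathsf d_v|+d}}\ \ (w\in\mathsf{Chi}_j(v)),\qquad \mathfrak c_a(t)=\frac{t+d}{t+a},$$ and let $E=\bigcap_j\ker S_j^*$. For $F\subseteq\{1,\dots,d\}$ let $\Phi_F$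 be the set of $u\in V$ such that $u_j\ne\mathsf{root}_j$ exactly for $j\in F$. For $u\in\Phi_F$ let $\mathsf{sib}_F(u)$ be the set of $w\in V$ such that $w_j$ and $u_j$ have the same parent for $j\in F$ and $w_j=u_j$ for $j\notin F$. Let $\Omega_F\subseteq\Phi_F$ contain exactly one element of each of the classes $\mathsf{sib}_F(u)$, and let $\mathcal L_{u,F}\subseteq E$ be the space of functions $f$ supported on $\mathsf{sib}_F(u)$ such that, for all $j\in F$ and $v\in\mathsf{sib}_F(u)$, $\sum_w f(w)\lambda_j(w)=0$, where $w$ runs over the vertices in $\mathsf{sib}_F(u)$ with $w_i=v_i$ for all $i\ne j$. Let $\mathscr H_{\mathfrak c_a}(\mathscr T)$ be the reproducing kernel Hilbert space of $E$-valued functions on the open unit ball $\mathbb B^d$ of $\mathbb C^d$ with kernel $$\kappa(z,w)=\sum_{F\subseteq\{1,\dots,d\}}\sum_{u\in\Omega_F}\Big(\sum_{\alpha\in\mathbb N^d}\frac{\mathsf d_u!}{(\mathsf d_u+\alpha)!}\prod_{i=0}^{|\alpha|-1}(|\mathsf d_u|+a+i)\,z^\alpha\overline w^{\alpha}\Big)P_{\mathcal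 L_{u,F}},$$ where $P_{\mathcal L_{u,F}}$ is the orthogonal projection of $E$ onto $\mathcal L_{u,F}$, and let $\mathscr H_a$ be the reproducing kernel Hilbert space of complex functions on $\mathbb B^d$ with kernel $(1-\langle z,w\rangle)^{-a}$. Then both kernels are positive semidefinite, and both spaces are invariant under multiplication by the coordinate functions, hence are Hilbert modules over $\mathbb C[z_1,\dots,z_d]$. Moreover, $\mathscr H_{\mathfrak c_a}(\mathscr T)$ and $\mathscr H_a$ are isomorphic as Hilbert modules (there is a unitary map $U:\mathscr H_{\mathfrak c_a}(\mathscr T)\to\mathscr H_a$ that intertwines the multiplications by $z_k$ for $k=1,\dots,d$) if and only if, for every $j=1,\dots,d$, the tree $\mathscr T_j$ is graph isomorphic to the rooted directed tree without branching vertices, that is, the tree with vertex set $\mathbb N$, root $0$ and edges $n\to n+1$. -/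

import Mathlib

noncomputable section

namespace TreeModule

universe u

/-! ### Rooted directed trees -/

/-- A locally finite, leafless, rooted directed tree with vertex set `V`: a connected directed graph
without circuits (in particular without loops) in which every vertex has at most one parent, with a
vertex `root` that has no parent, and in which every vertex has finitely many and at least one
child. (Such a tree is automatically countably infinite.) -/
structure RootedTree (V : Type u) where
  /-- `Adj u v`: there is a directed edge from the parent `u` to the child `v`. -/
  Adj : V → V → Prop
  root : V
  no_circuit : ∀ v, ¬ Relation.TransGen Adj v v
  connected : ∀ u v, Relation.EqvGen Adj u v
  parent_unique : ∀ u v w, Adj u w → Adj v w → u = v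
  root_no_parent : ∀ u, ¬ Adj u root
  locally_finite : ∀ u, {v | Adj u v}.Finite
  leafless : ∀ u, ∃ v, Adj u v

namespace RootedTree

variable {V : Type u} (T : RootedTree V)

/-- The set of children of a vertex. -/
def children (v : V) : Set V := {w | T.Adj v w}

open Classical in
/-- The parent of a vertex; by convention `par root = root`. -/
def par (v : V) : V := if h : ∃ u, T.Adj u v then h.choose else v

/-- The siblings of `v` (including `v` itself): the children of the parent of `v`. It is empty for
the root. -/
def sib (v : V) : Set V := {w | ∃ u, T.Adj u v ∧ T.Adj u w}

/-- The vertices that are reached from `v` by a directed path with `n` edges. -/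
def descendants (v : V) : ℕ → Set V
  | 0 => {v}
  | n + 1 => {w | ∃ u ∈ descendants v n, T.Adj u w}

/-- The depth of a vertex: the (unique) `n` such that `v` is an `n`-th descendant of the root. -/
def depth (v : V) : ℕ := sInf {n | v ∈ T.descendants T.root n}

/-- A branching vertex is a vertex with at least two children. -/
def IsBranching (v : V) : Prop := 2 ≤ (T.children v).ncard

/-- The branching index (one plus the supremum of the depths of the branching vertices, or zero if
there is no branching vertex) is finite. -/
def FiniteBranchingIndex : Prop := BddAbove (T.depth '' {v | T.IsBranching v})

lemma adj_par {v : V} (h : ∃ u, T.Adj u v) : T.Adj (T.par v) v := by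
  unfold par
  rw [dif_pos h]
  exact h.choose_spec

lemma exists_parent {v : V} (hv : v ≠ T.root) : ∃ u, T.Adj u v := by
  have key : ∀ a b, Relation.EqvGen T.Adj a b →
      ((Relation.ReflTransGen T.Adj T.root a) ↔ (Relation.ReflTransGen T.Adj T.root b)) := by
    intro a b h
    induction h with
    | rel a b h =>
      constructor
      · intro h1
        exact h1.tail h
      · intro h1
        rcases Relation.ReflTransGen.cases_tail h1 with h2 | ⟨c, hc, hcb⟩
        · subst h2
          exact absurd h (T.root_no_parent a)
        · rwa [T.parent_unique a c b h hcb]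
    | refl a => exact Iff.rfl
    | symm a b _ ih => exact ih.symm
    | trans a b c _ _ ih1 ih2 => exact ih1.trans ih2
  rcases Relation.ReflTransGen.cases_tail
    ((key _ _ (T.connected T.root v)).1 Relation.ReflTransGen.refl) with h | ⟨c, _, hc⟩
  · exact absurd h hv
  · exact ⟨c, hc⟩

lemma sib_finite (v : V) : (T.sib v).Finite := by
  by_cases h : ∃ u, T.Adj u v
  · obtain ⟨u, hu⟩ := h
    refine (T.locally_finite u).subset ?_
    rintro w ⟨p, hp, hw⟩
    rw [T.parent_unique u p v hu hp]
    exact hw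
  · refine Set.finite_empty.subset ?_
    rintro w ⟨p, hp, -⟩
    exact h ⟨p, hp⟩

end RootedTree

/-- The rooted directed tree without branching vertices: the vertices are the natural numbers, the
root is `0`, and there is an edge from `n` to `n + 1` for every `n`. -/
def rayTree : RootedTree ℕ where
  Adj m n := n = m + 1
  root := 0
  no_circuit v h := by
    have : ∀ w, Relation.TransGen (fun m n : ℕ => n = m + 1) v w → v < w := by
      intro w h
      induction h with
      | single h => omega
      | tail _ h ih => omega
    exact lt_irrefl _ (this v h)
  connected := by
    have h0 : ∀ n : ℕ, Relation.EqvGen (fun m n : ℕ => n = m + 1) 0 n := by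
      intro n
      induction n with
      | zero => exact .refl _
      | succ k ih => exact .trans _ _ _ ih (.rel _ _ rfl)
    exact fun u v => .trans _ _ _ (.symm _ _ (h0 u)) (h0 v)
  parent_unique u v w h1 h2 := by omega
  root_no_parent u h := by omega
  locally_finite u := by simp
  leafless u := ⟨u + 1, rfl⟩

lemma rayTree_not_isBranching (n : ℕ) : ¬ rayTree.IsBranching n := by
  have : rayTree.children n = {n + 1} := rfl
  simp [RootedTree.IsBranching, this]

/-- Two directed trees are graph isomorphic if there is a bijection between their vertex sets that
preserves (and reflects) directed edges. -/
def GraphIsomorphic {V : Type*} {W : Type*} (T : RootedTree V) (T' : RootedTree W) : Prop :=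
  ∃ e : V ≃ W, ∀ u v, T.Adj u v ↔ T'.Adj (e u) (e v)

/-! ### The directed Cartesian product and the multishift

The vertex set of the directed Cartesian product of `T 0, …, T (d - 1)` is `∀ j, V j`. -/

section Product

variable {d : ℕ} {V : Fin d → Type u} (T : ∀ j, RootedTree (V j))

/-- The depth of a vertex of the product, a multiindex. -/
def mdepth (v : ∀ j, V j) : Fin d → ℕ := fun j => (T j).depth (v j)

/-- The parent of `v` in the direction `j`. -/
def parAt (j : Fin d) (v : ∀ i, V i) : ∀ i, V i := Function.update v j ((T j).par (v j))

/-- The siblings of `v` in the direction `j`. -/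
def sibAt (j : Fin d) (v : ∀ i, V i) : Set (∀ i, V i) :=
  {w | w j ∈ (T j).sib (v j) ∧ ∀ i, i ≠ j → w i = v i}

/-- The vertices whose coordinates are different from the root exactly at the indices in `F`. -/
def Phi (F : Finset (Fin d)) : Set (∀ i, V i) := {v | ∀ j, v j ≠ (T j).root ↔ j ∈ F}

/-- `sib_F(u)`: the vertices obtained from `u` by replacing each coordinate `u j`, `j ∈ F`, by one
of its siblings. -/
def sibF (F : Finset (Fin d)) (u : ∀ i, V i) : Set (∀ i, V i) :=
  {w | (∀ j ∈ F, w j ∈ (T j).sib (u j)) ∧ ∀ j, j ∉ F → w j = u j}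

/-- An indexing set corresponding to `F`: it contains exactly one element of each of the classes
`sib_F(u)`, `u ∈ Φ_F`, namely the one picked by the axiom of choice. -/
def Omega (F : Finset (Fin d)) : Set (∀ i, V i) :=
  {u | u ∈ Phi T F ∧ ∀ h : (sibF T F u).Nonempty, h.some = u}

open Classical in
/-- `v_F`: the coordinates with index outside `F` are replaced by the roots. -/
def restrictTo (F : Finset (Fin d)) (v : ∀ i, V i) : ∀ i, V i :=
  fun j => if j ∈ F then v j else (T j).root

/-- The weights attached to a sequence `c` of positive numbers:
if `w` is a child of `v` in the direction `j`, then
`λ_j(w) = √(c(|d_v|) / card (Chi_j v)) * √((d_{v_j} + 1) / (|d_v| + d))`. -/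
def weight (c : ℕ → ℝ) (j : Fin d) (w : ∀ i, V i) : ℝ :=
  √(c (∑ i, mdepth T (parAt T j w) i) / ((T j).children (parAt T j w j)).ncard) *
    √((mdepth T (parAt T j w) j + 1) / ((∑ i, mdepth T (parAt T j w) i : ℕ) + d))

/-- The sequence `c_a(t) = (t + d) / (t + a)`. -/
def cSeq (a d : ℕ) (t : ℕ) : ℝ := ((t : ℝ) + d) / ((t : ℝ) + a)

/-- The complex Hilbert space of square summable functions on the vertex set of the product. -/
abbrev L2 (V : Fin d → Type u) : Type u := lp (fun _ : (∀ i, V i) => ℂ) 2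

open Classical in
/-- The action `(Λ_j f)(w) = λ_j(w) f(par_j(w))` (and `0` if `w j` is the root) of the `j`-th
component of the multishift with weights `λ_{c_a}` on functions on the vertex set. -/
def shiftFun (a : ℕ) (j : Fin d) (f : (∀ i, V i) → ℂ) : (∀ i, V i) → ℂ :=
  fun w => if w j = (T j).root then 0 else (weight T (cSeq a d) j w : ℂ) * f (parAt T j w)

lemma weight_sq_le (a : ℕ) (j : Fin d) (w : ∀ i, V i) :
    weight T (cSeq a d) j w ^ 2 ≤
      ((d : ℝ) + 1) * (((T j).children (parAt T j w j)).ncard : ℝ)⁻¹ := by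
  unfold weight
  set t : ℕ := ∑ i, mdepth T (parAt T j w) i with ht
  set b : ℕ := mdepth T (parAt T j w) j with hb
  set n : ℕ := ((T j).children (parAt T j w j)).ncard
  have hbt : b ≤ t := Finset.single_le_sum (f := fun i => mdepth T (parAt T j w) i)
    (fun i _ => Nat.zero_le _) (Finset.mem_univ j)
  have hd : (1 : ℝ) ≤ d := by
    have : 0 < d := j.pos
    exact_mod_cast this
  have hc0 : 0 ≤ cSeq a d t := by unfold cSeq; positivity
  have hc : cSeq a d t ≤ (d : ℝ) + 1 := by
    unfold cSeq
    rcases Nat.eq_zero_or_pos (t + a) with h | h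
    · have h' : (t : ℝ) + a = 0 := by exact_mod_cast h
      rw [h']
      simp only [div_zero]
      positivity
    · have h1 : (1 : ℝ) ≤ (t : ℝ) + a := by exact_mod_cast h
      rw [div_le_iff₀ (by linarith)]
      have : (0 : ℝ) ≤ a := Nat.cast_nonneg a
      have : (0 : ℝ) ≤ t := Nat.cast_nonneg t
      nlinarith
  have hq : ((b : ℝ) + 1) / ((t : ℝ) + d) ≤ 1 := by
    have : (b : ℝ) ≤ t := by exact_mod_cast hbt
    rw [div_le_one (by positivity)]
    linarith
  have hq0 : 0 ≤ ((b : ℝ) + 1) / ((t : ℝ) + d) := by positivity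
  rw [mul_pow, Real.sq_sqrt (by positivity), Real.sq_sqrt hq0, div_eq_mul_inv]
  have hn : (0 : ℝ) ≤ (n : ℝ)⁻¹ := by positivity
  calc cSeq a d t * (n : ℝ)⁻¹ * (((b : ℝ) + 1) / ((t : ℝ) + d))
      ≤ cSeq a d t * (n : ℝ)⁻¹ * 1 := by gcongr
    _ ≤ ((d : ℝ) + 1) * (n : ℝ)⁻¹ := by rw [mul_one]; gcongr

lemma sum_shiftFun_le (a : ℕ) (j : Fin d) (f : L2 V) (s : Finset (∀ i, V i)) :
    ∑ w ∈ s, ‖shiftFun T a j f w‖ ^ (2 : ENNReal).toReal ≤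
      ((d : ℝ) + 1) * ‖f‖ ^ (2 : ENNReal).toReal := by
  classical
  have h2 : (2 : ENNReal).toReal = (2 : ℕ) := by simp
  rw [h2]
  simp only [Real.rpow_natCast]
  set s' := s.filter (fun w => w j ≠ (T j).root) with hs'
  have e1 : ∑ w ∈ s, ‖shiftFun T a j f w‖ ^ 2 = ∑ w ∈ s', ‖shiftFun T a j f w‖ ^ 2 := by
    rw [hs', Finset.sum_filter]
    refine Finset.sum_congr rfl fun w _ => ?_
    by_cases h : w j = (T j).root <;> simp [shiftFun, h]
  have e2 : ∀ w ∈ s', ‖shiftFun T a j f w‖ ^ 2 ≤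
      ((d : ℝ) + 1) * (((T j).children (parAt T j w j)).ncard : ℝ)⁻¹ * ‖f (parAt T j w)‖ ^ 2 := by
    intro w hw
    have hw' : w j ≠ (T j).root := (Finset.mem_filter.1 hw).2
    simp only [shiftFun, if_neg hw', norm_mul, mul_pow, Complex.norm_real, Real.norm_eq_abs, sq_abs]
    gcongr
    exact weight_sq_le T a j w
  have e3 : ∀ u, ((s'.filter (fun w => parAt T j w = u)).card : ℝ) ≤
      ((T j).children (u j)).ncard := by
    intro u
    have : (s'.filter (fun w => parAt T j w = u)).card ≤ ((T j).children (u j)).ncard := by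
      rw [← Set.ncard_coe_finset]
      refine Set.ncard_le_ncard_of_injOn (fun w => w j) ?_ ?_ ((T j).locally_finite (u j))
      · intro w hw
        simp only [Finset.coe_filter, Set.mem_ofPred_eq, hs', Finset.mem_filter] at hw
        obtain ⟨⟨_, hw1⟩, hw2⟩ := hw
        have h := (T j).adj_par ((T j).exists_parent hw1)
        have : u j = (T j).par (w j) := by rw [← hw2]; simp [parAt]
        rw [← this] at h
        exact h
      · intro w hw w' hw' hj
        simp only [Finset.coe_filter, Set.mem_ofPred_eq] at hw hw'
        have h := hw.2.trans hw'.2.symm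
        funext i
        by_cases hi : i = j
        · subst hi; exact hj
        · have := congrFun h i
          simpa [parAt, hi] using this
    exact_mod_cast this
  rw [e1]
  calc ∑ w ∈ s', ‖shiftFun T a j f w‖ ^ 2
      ≤ ∑ w ∈ s', ((d : ℝ) + 1) * (((T j).children (parAt T j w j)).ncard : ℝ)⁻¹ *
          ‖f (parAt T j w)‖ ^ 2 := Finset.sum_le_sum e2
    _ = ∑ u ∈ s'.image (parAt T j), ∑ w ∈ s' with parAt T j w = u,
          ((d : ℝ) + 1) * (((T j).children (parAt T j w j)).ncard : ℝ)⁻¹ *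
            ‖f (parAt T j w)‖ ^ 2 :=
        (Finset.sum_fiberwise_of_maps_to (fun w hw => Finset.mem_image_of_mem _ hw) _).symm
    _ = ∑ u ∈ s'.image (parAt T j), ((s'.filter (fun w => parAt T j w = u)).card : ℝ) *
          (((d : ℝ) + 1) * (((T j).children (u j)).ncard : ℝ)⁻¹ * ‖f u‖ ^ 2) := by
        refine Finset.sum_congr rfl fun u _ => ?_
        rw [← nsmul_eq_mul, ← Finset.sum_const]
        refine Finset.sum_congr rfl fun w hw => ?_
        rw [(Finset.mem_filter.1 hw).2]
    _ ≤ ∑ u ∈ s'.image (parAt T j), ((d : ℝ) + 1) * ‖f u‖ ^ 2 := by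
        refine Finset.sum_le_sum fun u _ => ?_
        have h1 := e3 u
        set n : ℝ := (((T j).children (u j)).ncard : ℝ) with hn
        set m : ℝ := ((s'.filter (fun w => parAt T j w = u)).card : ℝ) with hm
        have hm0 : 0 ≤ m := by positivity
        have h2 : m * n⁻¹ ≤ 1 := by
          rw [← div_eq_mul_inv]
          exact div_le_one_of_le₀ h1 (by positivity)
        calc m * (((d : ℝ) + 1) * n⁻¹ * ‖f u‖ ^ 2)
            = (m * n⁻¹) * (((d : ℝ) + 1) * ‖f u‖ ^ 2) := by ring
          _ ≤ 1 * (((d : ℝ) + 1) * ‖f u‖ ^ 2) := by gcongr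
          _ = _ := one_mul _
    _ ≤ ((d : ℝ) + 1) * ‖f‖ ^ 2 := by
        rw [← Finset.mul_sum]
        have := lp.sum_rpow_le_norm_rpow (p := 2) (by simp) f (s'.image (parAt T j))
        rw [h2] at this
        simp only [Real.rpow_natCast] at this
        gcongr

/-- The `j`-th component `S_j` of the Drury-Arveson-type multishift, as a bounded operator. -/
def shift (a : ℕ) (j : Fin d) : L2 V →L[ℂ] L2 V :=
  LinearMap.mkContinuous
    { toFun := fun f => ⟨shiftFun T a j f, memℓp_gen' (sum_shiftFun_le T a j f)⟩
      map_add' := fun f g => by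
        ext w
        change shiftFun T a j (f + g : L2 V) w = shiftFun T a j f w + shiftFun T a j g w
        by_cases h : w j = (T j).root <;> simp [shiftFun, h, mul_add]
      map_smul' := fun c f => by
        ext w
        change shiftFun T a j (c • f : L2 V) w = c * shiftFun T a j f w
        by_cases h : w j = (T j).root <;> simp [shiftFun, h, mul_left_comm] }
    (√((d : ℝ) + 1)) (by
      intro f
      refine lp.norm_le_of_forall_sum_le (p := 2) (by simp) (by positivity) fun s => ?_
      refine (sum_shiftFun_le T a j f s).trans (le_of_eq ?_)
      have h2 : (2 : ENNReal).toReal = (2 : ℕ) := by simp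
      rw [h2]
      simp only [Real.rpow_natCast]
      rw [mul_pow, Real.sq_sqrt (by positivity)])

/-- The joint kernel `E = ⋂ j, ker S_j^*` of the adjoint of the multishift. -/
def jointKernel (a : ℕ) : Submodule ℂ (L2 V) :=
  ⨅ j, LinearMap.ker (ContinuousLinearMap.adjoint (shift T a j)).toLinearMap

instance (a : ℕ) : CompleteSpace (jointKernel T a) := by
  refine IsClosed.completeSpace_coe (hs := ?_)
  simp only [jointKernel, Submodule.coe_iInf]
  exact isClosed_iInter fun j => ContinuousLinearMap.isClosed_ker _

lemma sibAt_finite (j : Fin d) (v : ∀ i, V i) : (sibAt T j v).Finite := by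
  refine Set.Finite.of_finite_image (f := fun w => w j) (((T j).sib_finite (v j)).subset ?_) ?_
  · rintro _ ⟨w, hw, rfl⟩
    exact hw.1
  · intro w hw w' hw' h
    funext i
    by_cases hi : i = j
    · subst hi; exact h
    · rw [hw.2 i hi, hw'.2 i hi]

open Classical in
/-- The solution space `L_{u,F}`, as a subspace of the joint kernel: the functions `f` supported on
`sib_F(u)` such that `∑ f(w) λ_j(w) = 0`, where `w` runs over `sib_j(v_G | u_j)`, for all `j ∈ F`,
`G = F \ {j}` and `v ∈ sib_F(u)`. Here `v_G | u_j` is `v_G` with its `j`-th coordinate replaced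
by `u_j`. -/
def solutionSpace (a : ℕ) (u : ∀ i, V i) (F : Finset (Fin d)) : Submodule ℂ (jointKernel T a) where
  carrier := {f | (∀ w, w ∉ sibF T F u → (f : L2 V) w = 0) ∧
    ∀ j ∈ F, ∀ v ∈ sibF T F u,
      ∑ w ∈ (sibAt_finite T j
          (Function.update (restrictTo T (F.erase j) v) j (u j))).toFinset,
        (f : L2 V) w * (weight T (cSeq a d) j w : ℂ) = 0}
  add_mem' := by
    rintro f g ⟨hf1, hf2⟩ ⟨hg1, hg2⟩
    refine ⟨fun w hw => by simp [hf1 w hw, hg1 w hw], fun j hj v hv => ?_⟩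
    simp only [Submodule.coe_add, lp.coeFn_add, Pi.add_apply, add_mul, Finset.sum_add_distrib,
      hf2 j hj v hv, hg2 j hj v hv, add_zero]
  zero_mem' := by simp
  smul_mem' := by
    rintro c f ⟨hf1, hf2⟩
    refine ⟨fun w hw => by simp [hf1 w hw], fun j hj v hv => ?_⟩
    simp only [Submodule.coe_smul, lp.coeFn_smul, Pi.smul_apply, smul_eq_mul, mul_assoc]
    rw [← Finset.mul_sum, hf2 j hj v hv, mul_zero]

instance (a : ℕ) (u : ∀ i, V i) (F : Finset (Fin d)) : CompleteSpace (solutionSpace T a u F) := by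
  have hc : ∀ w, Continuous fun f : jointKernel T a => (f : L2 V) w := fun w =>
    (lp.evalCLM ℂ (fun _ : (∀ i, V i) => ℂ) 2 w).continuous.comp continuous_subtype_val
  refine IsClosed.completeSpace_coe (hs := ?_)
  change IsClosed {f : jointKernel T a | _ ∧ _}
  simp only [Set.ofPred_and, Set.ofPred_forall]
  refine IsClosed.inter ?_ ?_
  · exact isClosed_iInter fun w => isClosed_iInter fun _ => isClosed_eq (hc w) continuous_const
  · exact isClosed_iInter fun j => isClosed_iInter fun _ => isClosed_iInter fun v =>
      isClosed_iInter fun _ => isClosed_eq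
        (continuous_finsetSum _ fun w _ => (hc w).mul continuous_const) continuous_const

/-! ### Reproducing kernels and Hilbert modules -/

/-- The open unit ball of `ℂ^d`, with the Euclidean norm. -/
abbrev UnitBall (d : ℕ) : Type := Metric.ball (0 : EuclideanSpace ℂ (Fin d)) 1

/-- The scalar series
`∑_α β! / (β + α)! * ∏_{i < |α|} (|β| + a + i) * z^α * conj(w)^α` attached to a multiindex `β`. -/
def scalarKernel (a : ℕ) (β : Fin d → ℕ) (z w : UnitBall d) : ℂ :=
  ∑' α : Fin d → ℕ,
    ((∏ i, ((β i).factorial : ℂ)) / ∏ i, ((β i + α i).factorial : ℂ)) *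
      (∏ i ∈ Finset.range (∑ j, α j), ((∑ j, β j : ℕ) + a + i : ℂ)) *
      ((∏ i, z.1 i ^ α i) * ∏ i, (starRingEnd ℂ) (w.1 i) ^ α i)

/-- The `B(E)`-valued reproducing kernel of `H_{c_a}(T)`. -/
def treeKernel (a : ℕ) :
    Matrix (UnitBall d) (UnitBall d) (jointKernel T a →L[ℂ] jointKernel T a) :=
  Matrix.of fun z w => ∑ F : Finset (Fin d), ∑ᶠ u ∈ Omega T F,
    scalarKernel a (mdepth T u) z w • (solutionSpace T a u F).starProjection

/-- The classical kernel `1 / (1 - ⟨z, w⟩)^a` on the unit ball of `ℂ^d`. -/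
def classicalKernel (d a : ℕ) : Matrix (UnitBall d) (UnitBall d) (ℂ →L[ℂ] ℂ) :=
  Matrix.of fun z w => (1 / (1 - ∑ i, z.1 i * (starRingEnd ℂ) (w.1 i)) ^ a) •
    ContinuousLinearMap.id ℂ ℂ

end Product

/-- The reproducing kernel Hilbert space `H_{c_a}(T)` (its kernel has to be positive). -/
abbrev TreeSpace {d : ℕ} {V : Fin d → Type u} (T : ∀ j, RootedTree (V j)) (a : ℕ)
    [Fact (treeKernel T a).PosSemidef] : Type u :=
  RKHS.OfKernel (treeKernel T a)

/-- The reproducing kernel Hilbert space `H_a` with kernel `1 / (1 - ⟨z, w⟩)^a`. -/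
abbrev ClassicalSpace (d a : ℕ) [Fact (classicalKernel d a).PosSemidef] : Type :=
  RKHS.OfKernel (classicalKernel d a)

section Modules

variable {d : ℕ}
variable {E₁ : Type*} [NormedAddCommGroup E₁] [InnerProductSpace ℂ E₁]
variable {E₂ : Type*} [NormedAddCommGroup E₂] [InnerProductSpace ℂ E₂]
variable {H₁ : Type*} [NormedAddCommGroup H₁] [InnerProductSpace ℂ H₁] [CompleteSpace H₁]
  [RKHS ℂ H₁ (UnitBall d) E₁]
variable {H₂ : Type*} [NormedAddCommGroup H₂] [InnerProductSpace ℂ H₂] [CompleteSpace H₂]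
  [RKHS ℂ H₂ (UnitBall d) E₂]

variable (H₁) in
/-- A Hilbert space of functions on the unit ball is a Hilbert module over `ℂ[z_1, …, z_d]`, with
polynomials acting by multiplication, if it is invariant under multiplication by each coordinate
function. (The multiplication operators are then automatically bounded, see `coordMul`.) -/
def IsHilbertModule : Prop :=
  ∀ (k : Fin d) (f : H₁), ∃ g : H₁, ∀ z : UnitBall d, g z = z.1 k • f z

/-- The operator `M_{z_k}` of multiplication by the `k`-th coordinate function. -/
def coordMul (h : IsHilbertModule H₁) (k : Fin d) : H₁ →L[ℂ] H₁ :=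
  ContinuousLinearMap.ofSeqClosedGraph
    (g := { toFun := fun f => (h k f).choose
            map_add' := fun f g => by
              refine RKHS.ext fun z => ?_
              rw [(h k _).choose_spec z, RKHS.coe_add, RKHS.coe_add, Pi.add_apply, Pi.add_apply,
                (h k f).choose_spec z, (h k g).choose_spec z, smul_add]
            map_smul' := fun c f => by
              refine RKHS.ext fun z => ?_
              rw [(h k _).choose_spec z, RingHom.id_apply, RKHS.coe_smul, RKHS.coe_smul,
                Pi.smul_apply, Pi.smul_apply, (h k f).choose_spec z]
              exact smul_comm _ _ _ }) (by
      intro s x y hx hy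
      refine RKHS.ext fun z => ?_
      have h1 := ((RKHS.continuous_eval (H := H₁) z).tendsto y).comp hy
      have h2 := (((RKHS.continuous_eval (H := H₁) z).tendsto x).comp hx).const_smul (z.1 k)
      refine tendsto_nhds_unique h1 ?_
      have e : ((h k x).choose : H₁) z = z.1 k • x z := (h k x).choose_spec z
      simp only [LinearMap.coe_mk, AddHom.coe_mk]
      rw [e]
      refine h2.congr fun n => ?_
      exact ((h k (s n)).choose_spec z).symm)

lemma coordMul_apply (h : IsHilbertModule H₁) (k : Fin d) (f : H₁) (z : UnitBall d) :
    coordMul h k f z = z.1 k • f z := (h k f).choose_spec z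

/-- Two Hilbert modules are isomorphic if there is a unitary map that intertwines the operators of
multiplication by the coordinate functions. -/
def HilbertModulesIsomorphic (h₁ : IsHilbertModule H₁) (h₂ : IsHilbertModule H₂) : Prop :=
  ∃ U : H₁ ≃ₗᵢ[ℂ] H₂, ∀ (k : Fin d) (f : H₁), U (coordMul h₁ k f) = coordMul h₂ k (U f)

end Modules

end TreeModule

end

/-! The vectors annihilated by the adjoints of all coordinate multiplications form an isomorphism
invariant of a Hilbert module. For `H_a` they form a line: if `f` is such a vector, then
`⟨k_w, f⟩ = ⟨(1 - ⟨z, w⟩) ^ a k_w, f⟩ = ⟨k_0, f⟩`, so `f` is constant. In `H_{c_a}(T)` every kernel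
function at the origin is such a vector, and the summands of the kernel at distinct pairs `(F, u)`
yield orthogonal kernel functions there: the root contributes one dimension, and a branching vertex
of `T_j`, through the difference of the basis vectors at two of its children, another one with
`F = {j}`. So an isomorphism excludes branching; without branching only the summand of the root
survives, and the two kernels agree on its line.

Positivity and invariance under the coordinates hold because the coefficients
`(d_u! / (d_u + α)!) ∏ (|d_u| + a + i)` of the scalar kernels are nonnegative and increase with `α`:
for `κ` such a kernel, `κ(z, w)` and `(1 - z_k conj w_k) κ(z, w)` are sums of `z ^ α * conj w ^ α`
with nonnegative coefficients. -/

noncomputable section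

open scoped ComplexConjugate InnerProductSpace

namespace TreeModule

section LinearCombination

variable {𝕜 A G G' : Type*} [RCLike 𝕜]
variable [NormedAddCommGroup G] [InnerProductSpace 𝕜 G]
variable [NormedAddCommGroup G'] [InnerProductSpace 𝕜 G']
variable {k : A → G} {k' : A → G'}

lemma inner_linearCombination (k : A → G) (f : A →₀ 𝕜) :
    ⟪Finsupp.linearCombination 𝕜 k f, Finsupp.linearCombination 𝕜 k f⟫_𝕜 =
      f.sum fun p c => f.sum fun q e => conj c * e * ⟪k p, k q⟫_𝕜 := by
  rw [Finsupp.linearCombination_apply, Finsupp.sum_inner]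
  simp only [Finsupp.sum, inner_smul_left, inner_smul_right, inner_sum, mul_assoc]
  exact Finset.sum_congr rfl fun _ _ => Finset.sum_congr rfl fun _ _ => mul_left_comm _ _ _

lemma norm_linearCombination_sq (k : A → G) (f : A →₀ 𝕜) :
    ‖Finsupp.linearCombination 𝕜 k f‖ ^ 2 =
      RCLike.re (f.sum fun p c => f.sum fun q e => conj c * e * ⟪k p, k q⟫_𝕜) := by
  rw [← inner_self_eq_norm_sq (𝕜 := 𝕜), inner_linearCombination]

lemma exists_continuousLinearMap_apply_eq [CompleteSpace G']
    (hk : DenseRange (Finsupp.linearCombination 𝕜 k))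
    (hle : ∀ f : A →₀ 𝕜,
      ‖Finsupp.linearCombination 𝕜 k' f‖ ≤ ‖Finsupp.linearCombination 𝕜 k f‖) :
    ∃ S : G →L[𝕜] G', ∀ p, S (k p) = k' p := by
  refine ⟨(Finsupp.linearCombination 𝕜 k').extendOfNorm (Finsupp.linearCombination 𝕜 k),
    fun p => ?_⟩
  have h := LinearMap.extendOfNorm_eq hk ⟨1, by simpa only [one_mul] using hle⟩
    (Finsupp.single p (1 : 𝕜))
  simpa only [Finsupp.linearCombination_single, one_smul] using h

lemma exists_linearIsometryEquiv_apply_eq [CompleteSpace G] [CompleteSpace G']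
    (hk : DenseRange (Finsupp.linearCombination 𝕜 k))
    (hk' : DenseRange (Finsupp.linearCombination 𝕜 k'))
    (hinner : ∀ p q, ⟪k p, k q⟫_𝕜 = ⟪k' p, k' q⟫_𝕜) :
    ∃ U : G ≃ₗᵢ[𝕜] G', ∀ p, U (k p) = k' p := by
  have hnorm (f : A →₀ 𝕜) :
      ‖Finsupp.linearCombination 𝕜 k' f‖ = ‖Finsupp.linearCombination 𝕜 k f‖ := by
    rw [← sq_eq_sq₀ (norm_nonneg _) (norm_nonneg _), norm_linearCombination_sq,
      norm_linearCombination_sq]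
    simp only [hinner]
  refine ⟨(LinearEquiv.refl 𝕜 _).extendOfIsometry _ _ hk hk' hnorm, fun p => ?_⟩
  have h := LinearEquiv.extendOfIsometry_eq (LinearEquiv.refl 𝕜 (A →₀ 𝕜))
    (e₁ := Finsupp.linearCombination 𝕜 k) (e₂ := Finsupp.linearCombination 𝕜 k') hk hk' hnorm
    (Finsupp.single p 1)
  simpa only [LinearEquiv.refl_apply, Finsupp.linearCombination_single, one_smul] using h

end LinearCombination

section ReproducingKernel

open RKHS

variable {𝕜 X E E' : Type*} [RCLike 𝕜]
variable [NormedAddCommGroup E] [InnerProductSpace 𝕜 E] [CompleteSpace E]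
variable [NormedAddCommGroup E'] [InnerProductSpace 𝕜 E'] [CompleteSpace E']
variable (H : Type*) [NormedAddCommGroup H] [InnerProductSpace 𝕜 H] [CompleteSpace H]
  [RKHS 𝕜 H X E]
variable (H' : Type*) [NormedAddCommGroup H'] [InnerProductSpace 𝕜 H'] [CompleteSpace H']
  [RKHS 𝕜 H' X E']

lemma denseRange_linearCombination_kerFun {B : Type*} {ℓ : B → E} (hℓ : Function.Surjective ℓ) :
    DenseRange (Finsupp.linearCombination 𝕜 fun p : X × B => kerFun H p.1 (ℓ p.2)) := by
  have hrange : Set.range (fun p : X × B => kerFun H p.1 (ℓ p.2)) =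
      {kerFun H x v | (x : X) (v : E)} := by
    ext f
    simp only [Set.mem_range, Prod.exists, Set.mem_ofPred_eq, hℓ.exists]
  rw [DenseRange, ← LinearMap.coe_range, Finsupp.range_linearCombination, hrange,
    Submodule.dense_iff_topologicalClosure_eq_top, kerFun_dense]

variable {H}

lemma exists_smul_of_posSemidef (φ : X → 𝕜)
    (hφ : (Matrix.of fun x y => (1 - φ x * conj (φ y)) • kernel H x y).PosSemidef) (f : H) :
    ∃ g : H, ∀ x, g x = φ x • f x := by
  have hle (c : X × E →₀ 𝕜) :
      ‖Finsupp.linearCombination 𝕜 (fun p : X × E => conj (φ p.1) • kerFun H p.1 p.2) c‖ ≤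
        ‖Finsupp.linearCombination 𝕜 (fun p : X × E => kerFun H p.1 p.2) c‖ := by
    rw [← sq_le_sq₀ (norm_nonneg _) (norm_nonneg _), norm_linearCombination_sq,
      norm_linearCombination_sq, ← sub_nonneg, ← map_sub]
    have hpos : _ ∧ _ := (posSemidef_tfae.out 0 1).mp hφ
    refine (hpos.2 c).trans_eq (congrArg _ ?_)
    simp only [Finsupp.sum, ← Finset.sum_sub_distrib]
    refine Finset.sum_congr rfl fun p _ => Finset.sum_congr rfl fun q _ => ?_
    simp only [Matrix.of_apply, FunLike.coe_smul, Pi.smul_apply, inner_smul_left,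
      inner_smul_right, kernel_inner, map_sub, map_mul, map_one, RCLike.conj_conj]
    ring
  obtain ⟨S, hS⟩ := exists_continuousLinearMap_apply_eq
    (denseRange_linearCombination_kerFun H Function.surjective_id) hle
  refine ⟨S.adjoint f, fun x => ext_inner_left 𝕜 fun v => ?_⟩
  calc ⟪v, S.adjoint f x⟫_𝕜 = ⟪S (kerFun H x v), f⟫_𝕜 := by
        rw [← kerFun_inner, ContinuousLinearMap.adjoint_inner_right]
    _ = ⟪conj (φ x) • kerFun H x v, f⟫_𝕜 := by rw [← hS (x, v)]; rfl
    _ = ⟪v, φ x • f x⟫_𝕜 := by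
        rw [inner_smul_left, RCLike.conj_conj, kerFun_inner, inner_smul_right]

variable (H)

lemma exists_linearIsometryEquiv_of_kernel_eq (ℓ : E →L[𝕜] E') (hℓ : Function.Surjective ℓ)
    (hker : ∀ x y v w, ⟪kernel H x y v, w⟫_𝕜 = ⟪kernel H' x y (ℓ v), ℓ w⟫_𝕜) :
    ∃ U : H ≃ₗᵢ[𝕜] H', ∀ f x v, ⟪ℓ v, U f x⟫_𝕜 = ⟪v, f x⟫_𝕜 := by
  have hinner (p q : X × E) : ⟪kerFun H p.1 p.2, kerFun H q.1 q.2⟫_𝕜 =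
      ⟪kerFun H' p.1 (ℓ p.2), kerFun H' q.1 (ℓ q.2)⟫_𝕜 := by
    rw [← kernel_inner, ← kernel_inner, hker]
  obtain ⟨U, hU⟩ := exists_linearIsometryEquiv_apply_eq
    (denseRange_linearCombination_kerFun H Function.surjective_id)
    (denseRange_linearCombination_kerFun H' hℓ) hinner
  refine ⟨U, fun f x v => ?_⟩
  rw [← kerFun_inner, ← hU (x, v), U.inner_map_map, kerFun_inner]
  rfl

end ReproducingKernel

/-- A scalar kernel is diagonal with respect to the functions `m i` if it is a sum of the rank one
kernels `m i x * conj (m i y)` with nonnegative coefficients. For kernels that are power series in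
`z` and `conj w`, this is a form of positivity that can be read off from the coefficients. -/
def IsDiagonalKernel {A X : Type*} (m : A → X → ℂ) (k : X → X → ℂ) : Prop :=
  ∃ c : A → ℝ, (∀ i, 0 ≤ c i) ∧ ∀ x y, HasSum (fun i => (c i : ℂ) * (m i x * conj (m i y))) (k x y)

section Diagonal

variable {A ι X E : Type*} [NormedAddCommGroup E] [InnerProductSpace ℂ E]
variable {m : A → X → ℂ} {k : X → X → ℂ} {P : E →L[ℂ] E}

lemma IsDiagonalKernel.conj_apply (h : IsDiagonalKernel m k) (x y : X) :
    conj (k x y) = k y x := by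
  obtain ⟨c, -, h⟩ := h
  have hconj : HasSum (fun i => conj ((c i : ℂ) * (m i x * conj (m i y)))) (conj (k x y)) :=
    Complex.hasSum_conj'.2 (by simpa only [RCLike.conj_conj] using h x y)
  refine HasSum.unique ?_ (h y x)
  simpa only [map_mul, Complex.conj_ofReal, RCLike.conj_conj, mul_comm] using hconj

lemma IsDiagonalKernel.sum_inner_nonneg (h : IsDiagonalKernel m k) (hP : P.IsPositive)
    (f : X →₀ E) :
    0 ≤ RCLike.re (f.sum fun x v => f.sum fun y w => ⟪k y x • P v, w⟫_ℂ) := by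
  have hconj := h.conj_apply
  obtain ⟨c, hc, hk⟩ := h
  let g (i : A) : E := f.sum fun x v => conj (m i x) • v
  have hsum : HasSum (fun i => (c i : ℂ) * ⟪P (g i), g i⟫_ℂ)
      (f.sum fun x v => f.sum fun y w => ⟪k y x • P v, w⟫_ℂ) := by
    simp only [g, Finsupp.sum, map_sum, sum_inner, inner_sum, Finset.mul_sum]
    rw [Finset.sum_comm]
    refine hasSum_sum fun y _ => hasSum_sum fun x _ => ?_
    convert! (hk x y).mul_right ⟪P (f x), f y⟫_ℂ using 1
    · funext i
      simp only [map_smul, inner_smul_left, inner_smul_right, RCLike.conj_conj]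
      ring
    · rw [inner_smul_left, hconj]
  refine (Complex.hasSum_re hsum).nonneg fun i => ?_
  rw [Complex.re_ofReal_mul]
  exact mul_nonneg (hc i) (hP.re_inner_nonneg_left (g i))

variable [CompleteSpace E]

lemma IsDiagonalKernel.posSemidef_smul (h : IsDiagonalKernel m k) (hP : P.IsPositive) :
    (Matrix.of fun x y => k x y • P).PosSemidef := by
  refine (RKHS.posSemidef_tfae.out 0 2).mpr (⟨?_, h.sum_inner_nonneg hP⟩ : _ ∧ _)
  ext x y : 2
  rw [Matrix.conjTranspose_apply, Matrix.of_apply, Matrix.of_apply, star_smul,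
    hP.isSelfAdjoint.star_eq, RCLike.star_def, h.conj_apply]

lemma posSemidef_sum_smul (s : Finset ι) {κ : ι → X → X → ℂ} {P : ι → E →L[ℂ] E}
    (hκ : ∀ i ∈ s, IsDiagonalKernel m (κ i)) (hP : ∀ i ∈ s, (P i).IsPositive) :
    (Matrix.of fun x y => ∑ i ∈ s, κ i x y • P i).PosSemidef := by
  have hsum : (Matrix.of fun x y => ∑ i ∈ s, κ i x y • P i) =
      ∑ i ∈ s, Matrix.of fun x y => κ i x y • P i := by
    ext x y : 2
    simp only [Matrix.of_apply, Matrix.sum_apply]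
  rw [hsum]
  exact Matrix.posSemidef_sum s fun i hi => (hκ i hi).posSemidef_smul (hP i hi)

end Diagonal

section MultinomialSeries

variable {ι 𝕜 : Type*} [Fintype ι] [RCLike 𝕜]

lemma hasSum_multinomial_fiber (c : ℕ → 𝕜) (x : ι → 𝕜) (n : ℕ) :
    HasSum (fun α : {α : ι → ℕ // ∑ i, α i = n} =>
        c (∑ i, α.1 i) * (Nat.multinomial Finset.univ α.1 * ∏ i, x i ^ α.1 i))
      (c n * (∑ i, x i) ^ n) := by
  classical
  have hmem (α : ι → ℕ) : ∑ i, α i = n ↔ α ∈ Finset.piAntidiag Finset.univ n := by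
    simp only [Finset.mem_piAntidiag, Finset.mem_univ, implies_true, and_true]
  rw [Finset.sum_pow_eq_sum_piAntidiag, Finset.mul_sum,
    ← (Equiv.subtypeEquivRight hmem).symm.hasSum_iff]
  convert! (Finset.piAntidiag Finset.univ n).hasSum
    fun α : ι → ℕ => c n * (Nat.multinomial Finset.univ α * ∏ i, x i ^ α i) using 1
  funext α
  simp only [Function.comp_apply, Equiv.subtypeEquivRight_symm_apply_coe, (hmem α).2 α.2]

lemma hasSum_multinomial (c : ℕ → 𝕜) (x : ι → 𝕜)
    (hs : Summable fun n => ‖c n‖ * (∑ i, ‖x i‖) ^ n) :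
    HasSum (fun α : ι → ℕ => c (∑ i, α i) * (Nat.multinomial Finset.univ α * ∏ i, x i ^ α i))
      (∑' n, c n * (∑ i, x i) ^ n) := by
  have hnorm : Summable fun α : ι → ℕ =>
      ‖c (∑ i, α i)‖ * (Nat.multinomial Finset.univ α * ∏ i, ‖x i‖ ^ α i) := by
    rw [← (Equiv.sigmaFiberEquiv fun α : ι → ℕ => ∑ i, α i).summable_iff]
    have hfiber := hasSum_multinomial_fiber (fun n => ‖c n‖) fun i => ‖x i‖
    refine (summable_sigma_of_nonneg fun p => ?_).2 ⟨fun n => (hfiber n).summable, ?_⟩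
    · exact mul_nonneg (norm_nonneg _) (by positivity)
    · exact hs.congr fun n => (hfiber n).tsum_eq.symm
  have hsum : Summable fun α : ι → ℕ =>
      c (∑ i, α i) * (Nat.multinomial Finset.univ α * ∏ i, x i ^ α i) :=
    Summable.of_norm (hnorm.congr fun α => by
      simp only [norm_mul, norm_prod, norm_pow, RCLike.norm_natCast])
  have hgroup := ((Equiv.sigmaFiberEquiv fun α : ι → ℕ => ∑ i, α i).hasSum_iff.2
    hsum.hasSum).sigma (hasSum_multinomial_fiber c x)
  rw [hgroup.tsum_eq]
  exact hsum.hasSum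

lemma hasSum_negativeBinomial (b : ℕ) {x : ι → 𝕜} (hx : ∑ i, ‖x i‖ < 1) :
    HasSum (fun α : ι → ℕ => ((∑ i, α i + b).choose b : 𝕜) *
        (Nat.multinomial Finset.univ α * ∏ i, x i ^ α i))
      (1 / (1 - ∑ i, x i) ^ (b + 1)) := by
  have hx' : ‖∑ i, ‖x i‖‖ < 1 := by
    rwa [Real.norm_of_nonneg (Finset.sum_nonneg fun i _ => norm_nonneg _)]
  rw [← tsum_choose_mul_geometric_of_norm_lt_one b ((norm_sum_le _ _).trans_lt hx)]
  refine hasSum_multinomial (fun n => ((n + b).choose b : 𝕜)) x ?_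
  simpa only [RCLike.norm_natCast] using summable_choose_mul_geometric_of_norm_lt_one b hx'

end MultinomialSeries

section KernelCoeff

variable {ι : Type*} [Fintype ι]

/-- The coefficient `β! / (β + α)! * ∏_{i < |α|} (|β| + a + i)` of `z ^ α * conj w ^ α` in
`scalarKernel a β`. -/
def kernelCoeff (a : ℕ) (β α : ι → ℕ) : ℝ :=
  (∏ i, ((β i).factorial : ℝ)) / (∏ i, ((β i + α i).factorial : ℝ)) *
    ∏ i ∈ Finset.range (∑ j, α j), ((∑ j, β j : ℕ) + a + i : ℝ)

lemma kernelCoeff_nonneg (a : ℕ) (β α : ι → ℕ) : 0 ≤ kernelCoeff a β α := by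
  unfold kernelCoeff
  positivity

lemma kernelCoeff_le_kernelCoeff_zero (a : ℕ) (β α : ι → ℕ) :
    kernelCoeff a β α ≤ kernelCoeff (∑ i, β i + a) 0 α := by
  simp only [kernelCoeff, Pi.zero_apply, Nat.factorial_zero, Nat.cast_one, Finset.prod_const_one,
    zero_add, Finset.sum_const_zero, Nat.cast_zero, Nat.cast_add]
  refine mul_le_mul_of_nonneg_right ?_ (by positivity)
  rw [div_le_div_iff₀ (by positivity) (by positivity), one_mul, ← Finset.prod_mul_distrib]
  refine Finset.prod_le_prod (fun i _ => by positivity) fun i _ => ?_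
  exact_mod_cast Nat.le_of_dvd (Nat.factorial_pos _)
    (Nat.factorial_mul_factorial_dvd_factorial_add _ _)

lemma kernelCoeff_succ_zero (b : ℕ) (α : ι → ℕ) :
    kernelCoeff (b + 1) 0 α = (∑ i, α i + b).choose b * Nat.multinomial Finset.univ α := by
  have hrising : (∏ i ∈ Finset.range (∑ j, α j), ((b + 1 : ℕ) + i : ℝ)) =
      (∑ j, α j).factorial * (∑ j, α j + b).choose b := by
    have h := (Nat.ascFactorial_eq_prod_range (b + 1) (∑ j, α j)).symm.trans
      (Nat.ascFactorial_eq_factorial_mul_choose b _)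
    rw [add_comm b (∑ j, α j), Nat.choose_symm_add] at h
    exact_mod_cast h
  have hmultinomial : (∏ i, ((α i).factorial : ℝ)) * Nat.multinomial Finset.univ α =
      (∑ j, α j).factorial := by
    exact_mod_cast Nat.multinomial_spec Finset.univ α
  have hne : (∏ i, ((α i).factorial : ℝ)) ≠ 0 := by positivity
  simp only [kernelCoeff, Pi.zero_apply, Nat.factorial_zero, Nat.cast_one, Finset.prod_const_one,
    zero_add, Finset.sum_const_zero, Nat.cast_zero, hrising, ← hmultinomial]
  field_simp

lemma hasSum_kernelCoeff_zero {𝕜 : Type*} [RCLike 𝕜] {a : ℕ} (ha : 0 < a) {x : ι → 𝕜}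
    (hx : ∑ i, ‖x i‖ < 1) :
    HasSum (fun α => (kernelCoeff a 0 α : 𝕜) * ∏ i, x i ^ α i) (1 / (1 - ∑ i, x i) ^ a) := by
  obtain ⟨b, rfl⟩ := Nat.exists_eq_add_one_of_ne_zero ha.ne'
  simpa only [kernelCoeff_succ_zero, RCLike.ofReal_mul, RCLike.ofReal_natCast, mul_assoc]
    using hasSum_negativeBinomial b hx

variable [DecidableEq ι]

lemma prod_factorial_add_single (γ : ι → ℕ) (k : ι) :
    ∏ i, ((γ + Pi.single k 1 : ι → ℕ) i).factorial = (γ k + 1) * ∏ i, (γ i).factorial := by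
  rw [← Finset.mul_prod_erase _ _ (Finset.mem_univ k),
    ← Finset.mul_prod_erase _ (fun i => (γ i).factorial) (Finset.mem_univ k), ← mul_assoc]
  congr 1
  · rw [Pi.add_apply, Pi.single_eq_same, Nat.factorial_succ]
  · refine Finset.prod_congr rfl fun i hi => ?_
    rw [Pi.add_apply, Pi.single_eq_of_ne (Finset.ne_of_mem_erase hi), add_zero]

lemma kernelCoeff_add_single (a : ℕ) (β α : ι → ℕ) (k : ι) :
    (β k + α k + 1) * kernelCoeff a β (α + Pi.single k 1) =
      (∑ i, β i + a + ∑ i, α i : ℕ) * kernelCoeff a β α := by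
  have hsum : ∑ i, (α + Pi.single k 1 : ι → ℕ) i = ∑ i, α i + 1 := by
    simp only [Pi.add_apply, Finset.sum_add_distrib, Finset.sum_pi_single', Finset.mem_univ,
      if_true]
  have hprod : ∏ i, ((β i + (α + Pi.single k 1 : ι → ℕ) i).factorial : ℝ) =
      (β k + α k + 1) * ∏ i, ((β i + α i).factorial : ℝ) := by
    have h := prod_factorial_add_single (β + α) k
    simp only [add_assoc, Pi.add_apply] at h ⊢
    exact_mod_cast h
  have hne : ∏ i, ((β i + α i).factorial : ℝ) ≠ 0 := by positivity
  have hne' : (β k + α k + 1 : ℝ) ≠ 0 := by positivity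
  unfold kernelCoeff
  rw [hsum, Finset.prod_range_succ, hprod]
  push_cast
  field_simp

lemma kernelCoeff_le_add_single {a : ℕ} (ha : 0 < a) (β α : ι → ℕ) (k : ι) :
    kernelCoeff a β α ≤ kernelCoeff a β (α + Pi.single k 1) := by
  have hβ : β k ≤ ∑ i, β i := Finset.single_le_sum (fun _ _ => Nat.zero_le _) (Finset.mem_univ k)
  have hα : α k ≤ ∑ i, α i := Finset.single_le_sum (fun _ _ => Nat.zero_le _) (Finset.mem_univ k)
  have hle : (β k + α k + 1 : ℝ) ≤ (∑ i, β i + a + ∑ i, α i : ℕ) := by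
    exact_mod_cast (by omega : β k + α k + 1 ≤ ∑ i, β i + a + ∑ i, α i)
  refine le_of_mul_le_mul_left ?_ (by positivity : (0 : ℝ) < β k + α k + 1)
  rw [kernelCoeff_add_single]
  exact mul_le_mul_of_nonneg_right hle (kernelCoeff_nonneg a β α)

end KernelCoeff

section ScalarKernel

variable {d : ℕ}

/-- The monomial `z ↦ z ^ α` as a function on the unit ball. -/
def monomialFun (α : Fin d → ℕ) (z : UnitBall d) : ℂ := ∏ i, z.1 i ^ α i

lemma monomialFun_add_single (α : Fin d → ℕ) (k : Fin d) (z : UnitBall d) :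
    monomialFun (α + Pi.single k 1) z = z.1 k * monomialFun α z := by
  simp only [monomialFun, Pi.add_apply, pow_add, Finset.prod_mul_distrib]
  rw [mul_comm, Finset.prod_eq_single k, Pi.single_eq_same, pow_one]
  · intro i _ hi
    rw [Pi.single_eq_of_ne hi, pow_zero]
  · exact fun hk => absurd (Finset.mem_univ k) hk

lemma monomialFun_mul_conj (α : Fin d → ℕ) (z w : UnitBall d) :
    monomialFun α z * conj (monomialFun α w) = ∏ i, (z.1 i * conj (w.1 i)) ^ α i := by
  simp only [monomialFun, map_prod, map_pow, mul_pow, Finset.prod_mul_distrib]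

lemma scalarKernel_eq_tsum (a : ℕ) (β : Fin d → ℕ) (z w : UnitBall d) :
    scalarKernel a β z w =
      ∑' α, (kernelCoeff a β α : ℂ) * (monomialFun α z * conj (monomialFun α w)) := by
  simp [scalarKernel, kernelCoeff, monomialFun]

lemma sum_norm_mul_conj_lt_one (z w : UnitBall d) : ∑ i, ‖z.1 i * conj (w.1 i)‖ < 1 := by
  have hz : ‖z.1‖ < 1 := mem_ball_zero_iff.1 z.2
  have hw : ‖w.1‖ < 1 := mem_ball_zero_iff.1 w.2
  have hcauchy := Finset.sum_mul_sq_le_sq_mul_sq Finset.univ (‖z.1 ·‖) (‖w.1 ·‖)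
  rw [← EuclideanSpace.norm_sq_eq, ← EuclideanSpace.norm_sq_eq, ← mul_pow] at hcauchy
  simp only [norm_mul, RCLike.norm_conj]
  exact (le_of_sq_le_sq hcauchy (by positivity)).trans_lt
    (mul_lt_one_of_nonneg_of_lt_one_left (norm_nonneg _) hz hw.le)

variable {a : ℕ}

lemma hasSum_scalarKernel (ha : 0 < a) (β : Fin d → ℕ) (z w : UnitBall d) :
    HasSum (fun α => (kernelCoeff a β α : ℂ) * (monomialFun α z * conj (monomialFun α w)))
      (scalarKernel a β z w) := by
  have hbound : Summable fun α : Fin d → ℕ =>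
      kernelCoeff (∑ i, β i + a) 0 α * ∏ i, ‖z.1 i * conj (w.1 i)‖ ^ α i := by
    refine (hasSum_kernelCoeff_zero (𝕜 := ℝ) (by omega) ?_).summable
    simpa only [norm_norm] using sum_norm_mul_conj_lt_one z w
  rw [scalarKernel_eq_tsum]
  refine (Summable.of_norm_bounded hbound fun α => ?_).hasSum
  rw [monomialFun_mul_conj, norm_mul, Complex.norm_real, norm_prod,
    Real.norm_of_nonneg (kernelCoeff_nonneg a β α)]
  simp only [norm_pow]
  gcongr
  exact kernelCoeff_le_kernelCoeff_zero a β α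

lemma isDiagonalKernel_scalarKernel (ha : 0 < a) (β : Fin d → ℕ) :
    IsDiagonalKernel monomialFun (scalarKernel (d := d) a β) :=
  ⟨_, kernelCoeff_nonneg a β, hasSum_scalarKernel ha β⟩

lemma isDiagonalKernel_sub_mul_scalarKernel (ha : 0 < a) (β : Fin d → ℕ) (k : Fin d) :
    IsDiagonalKernel monomialFun fun z w : UnitBall d =>
      (1 - z.1 k * conj (w.1 k)) * scalarKernel a β z w := by
  have hinj : Function.Injective fun α : Fin d → ℕ => α + Pi.single k 1 := add_left_injective _
  -- The coefficients of `z_k * conj w_k * scalarKernel a β z w`: those of `scalarKernel a β`,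
  -- shifted by one in the direction `k`.
  let c : (Fin d → ℕ) → ℝ := Function.extend (· + Pi.single k 1) (kernelCoeff a β) 0
  have hc_add (α) : c (α + Pi.single k 1) = kernelCoeff a β α := hinj.extend_apply _ _ α
  have hc_zero (α) (hα : ¬ ∃ γ : Fin d → ℕ, γ + Pi.single k 1 = α) : c α = 0 :=
    Function.extend_apply' _ _ _ hα
  refine ⟨fun α => kernelCoeff a β α - c α, fun α => sub_nonneg.2 ?_, fun z w => ?_⟩
  · by_cases hα : ∃ γ : Fin d → ℕ, γ + Pi.single k 1 = α
    · obtain ⟨γ, rfl⟩ := hα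
      exact (hc_add γ).trans_le (kernelCoeff_le_add_single ha β γ k)
    · exact (hc_zero α hα).trans_le (kernelCoeff_nonneg a β α)
  · have hsum := hasSum_scalarKernel ha β z w
    have hshift : HasSum (fun α => (c α : ℂ) * (monomialFun α z * conj (monomialFun α w)))
        (z.1 k * conj (w.1 k) * scalarKernel a β z w) := by
      refine (hinj.hasSum_iff fun α hα => ?_).1 ?_
      · rw [hc_zero α hα, Complex.ofReal_zero, zero_mul]
      · convert! hsum.mul_left (z.1 k * conj (w.1 k)) using 2 with α
        simp only [Function.comp_apply, hc_add, monomialFun_add_single, map_mul]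
        ring
    convert! hsum.sub hshift using 2 with α
    · rw [Complex.ofReal_sub, sub_mul]
    · ring

lemma scalarKernel_zero (ha : 0 < a) (z w : UnitBall d) :
    scalarKernel a 0 z w = 1 / (1 - ∑ i, z.1 i * conj (w.1 i)) ^ a := by
  refine (hasSum_scalarKernel ha 0 z w).unique ?_
  simp only [monomialFun_mul_conj]
  exact hasSum_kernelCoeff_zero ha (sum_norm_mul_conj_lt_one z w)

/-- The centre of the unit ball, at which the kernels are evaluated to find the joint kernel of the
adjoints of the coordinate multiplications. -/
def origin (d : ℕ) : UnitBall d := ⟨0, Metric.mem_ball_self one_pos⟩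

lemma scalarKernel_origin (β : Fin d → ℕ) (z : UnitBall d) :
    scalarKernel a β z (origin d) = 1 := by
  rw [scalarKernel_eq_tsum, tsum_eq_single 0]
  · have hne : (∏ i, ((β i).factorial : ℝ)) ≠ 0 := by positivity
    simp [kernelCoeff, monomialFun, div_self hne]
  · intro α hα
    obtain ⟨i, hi⟩ := Function.ne_iff.1 hα
    have horigin : monomialFun α (origin d) = 0 :=
      Finset.prod_eq_zero (Finset.mem_univ i) (zero_pow hi)
    rw [horigin, map_zero, mul_zero, mul_zero]

end ScalarKernel

section ProjectionKernel

variable {d a : ℕ} {ι E : Type*} [NormedAddCommGroup E] [InnerProductSpace ℂ E]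
variable {s : Finset ι} {β : ι → Fin d → ℕ} {L : ι → Submodule ℂ E}
  [∀ i, (L i).HasOrthogonalProjection]

/-- The common form of the operator valued kernels of `H_{c_a}(T)` and `H_a`: a finite sum of
scalar kernels times orthogonal projections. -/
def projectionKernel (a : ℕ) (s : Finset ι) (β : ι → Fin d → ℕ) (L : ι → Submodule ℂ E)
    [∀ i, (L i).HasOrthogonalProjection] : Matrix (UnitBall d) (UnitBall d) (E →L[ℂ] E) :=
  Matrix.of fun z w => ∑ i ∈ s, scalarKernel a (β i) z w • (L i).starProjection

variable [CompleteSpace E]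

lemma isPositive_starProjection (K : Submodule ℂ E) [K.HasOrthogonalProjection] :
    K.starProjection.IsPositive :=
  .of_isStarProjection isStarProjection_starProjection

lemma posSemidef_projectionKernel (ha : 0 < a) : (projectionKernel a s β L).PosSemidef :=
  posSemidef_sum_smul s (fun i _ => isDiagonalKernel_scalarKernel ha (β i))
    fun i _ => isPositive_starProjection (L i)

variable {H : Type*} [NormedAddCommGroup H] [InnerProductSpace ℂ H] [CompleteSpace H]
  [RKHS ℂ H (UnitBall d) E]

lemma isHilbertModule_of_kernel_eq (ha : 0 < a) (hK : RKHS.kernel H = projectionKernel a s β L) :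
    IsHilbertModule H := by
  intro k f
  refine exists_smul_of_posSemidef (fun z => z.1 k) ?_ f
  simp only [hK, projectionKernel, Matrix.of_apply, Finset.smul_sum, smul_smul]
  exact posSemidef_sum_smul s (fun i _ => isDiagonalKernel_sub_mul_scalarKernel ha (β i) k)
    fun i _ => isPositive_starProjection (L i)

lemma norm_kerFun_origin_sq (hK : RKHS.kernel H = projectionKernel a s β L) (η : E) :
    ‖RKHS.kerFun H (origin d) η‖ ^ 2 = ∑ i ∈ s, ‖(L i).starProjection η‖ ^ 2 := by
  rw [← inner_self_eq_norm_sq (𝕜 := ℂ), ← RKHS.kernel_inner, hK]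
  simp only [projectionKernel, Matrix.of_apply, scalarKernel_origin, one_smul, sum_apply,
    sum_inner, map_sum]
  exact Finset.sum_congr rfl fun i _ => (L i).re_inner_starProjection_eq_normSq η

lemma starProjection_eq_zero_of_kerFun_origin_eq_zero
    (hK : RKHS.kernel H = projectionKernel a s β L) {i : ι} (hi : i ∈ s) {η : E}
    (hη : RKHS.kerFun H (origin d) η = 0) : (L i).starProjection η = 0 := by
  have hsum := norm_kerFun_origin_sq hK η
  rw [hη, norm_zero, zero_pow two_ne_zero, eq_comm,
    Finset.sum_eq_zero_iff_of_nonneg fun _ _ => sq_nonneg _] at hsum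
  exact norm_eq_zero.1 (pow_eq_zero_iff two_ne_zero |>.1 (hsum i hi))

end ProjectionKernel

section HilbertModule

variable {d : ℕ} {E E' : Type*} [NormedAddCommGroup E] [InnerProductSpace ℂ E]
  [NormedAddCommGroup E'] [InnerProductSpace ℂ E']
variable {H : Type*} [NormedAddCommGroup H] [InnerProductSpace ℂ H] [CompleteSpace H]
  [RKHS ℂ H (UnitBall d) E]
variable {H' : Type*} [NormedAddCommGroup H'] [InnerProductSpace ℂ H'] [CompleteSpace H']
  [RKHS ℂ H' (UnitBall d) E']

/-- The joint kernel of the adjoints of the coordinate multiplications of a Hilbert module; it is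
an isomorphism invariant of the module. -/
def adjointKernel (h : IsHilbertModule H) : Submodule ℂ H :=
  ⨅ k, LinearMap.ker (ContinuousLinearMap.adjoint (coordMul h k)).toLinearMap

lemma mem_adjointKernel_iff {h : IsHilbertModule H} {f : H} :
    f ∈ adjointKernel h ↔ ∀ k g, ⟪coordMul h k g, f⟫_ℂ = 0 := by
  simp only [adjointKernel, Submodule.mem_iInf, LinearMap.mem_ker, ContinuousLinearMap.coe_coe,
    ← ContinuousLinearMap.adjoint_inner_right]
  refine forall_congr' fun k => ⟨fun hf g => by rw [hf, inner_zero_right], fun hf =>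
    ext_inner_left ℂ fun g => by rw [hf, inner_zero_right]⟩

lemma map_mem_adjointKernel {h : IsHilbertModule H} {h' : IsHilbertModule H'} {U : H ≃ₗᵢ[ℂ] H'}
    (hU : ∀ k f, U (coordMul h k f) = coordMul h' k (U f)) {f : H} (hf : f ∈ adjointKernel h) :
    U f ∈ adjointKernel h' := by
  rw [mem_adjointKernel_iff] at hf ⊢
  refine fun k => U.surjective.forall.2 fun g => ?_
  rw [← hU, U.inner_map_map, hf]

lemma kerFun_origin_mem_adjointKernel [CompleteSpace E] (h : IsHilbertModule H) (η : E) :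
    RKHS.kerFun H (origin d) η ∈ adjointKernel h := by
  refine mem_adjointKernel_iff.2 fun k g => ?_
  rw [RKHS.inner_kerFun, coordMul_apply, origin, PiLp.zero_apply, zero_smul, inner_zero_left]

/-- The operator of multiplication by the function `z ↦ ⟨z, w⟩`. -/
def pairingMul (h : IsHilbertModule H) (w : UnitBall d) : H →L[ℂ] H :=
  ∑ k, conj (w.1 k) • coordMul h k

lemma pairingMul_apply (h : IsHilbertModule H) (w z : UnitBall d) (f : H) :
    pairingMul h w f z = (∑ k, z.1 k * conj (w.1 k)) • f z := by
  have heval := map_sum ((ContinuousLinearMap.proj z).comp (RKHS.coeCLM ℂ (H := H)))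
    (fun k => conj (w.1 k) • coordMul h k f) Finset.univ
  simp only [ContinuousLinearMap.comp_apply, RKHS.coeCLM_apply, ContinuousLinearMap.proj_apply,
    RKHS.coe_smul, Pi.smul_apply, coordMul_apply, smul_smul, mul_comm (conj _)] at heval
  simpa only [pairingMul, sum_apply, FunLike.coe_smul, Pi.smul_apply, Finset.sum_smul] using heval

lemma one_sub_pairingMul_pow_apply (h : IsHilbertModule H) (w z : UnitBall d) (f : H) (n : ℕ) :
    ((1 - pairingMul h w) ^ n) f z = (1 - ∑ k, z.1 k * conj (w.1 k)) ^ n • f z := by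
  induction n with
  | zero => simp only [pow_zero, one_apply_eq_self, one_smul]
  | succ n ih =>
    rw [pow_succ', mul_apply_eq_comp, sub_apply,
      one_apply_eq_self, RKHS.coe_sub, Pi.sub_apply, pairingMul_apply, ih,
      smul_smul, ← sub_smul]
    congr 1
    ring

lemma inner_one_sub_pairingMul_pow {h : IsHilbertModule H} {f : H} (hf : f ∈ adjointKernel h)
    (w : UnitBall d) (g : H) (n : ℕ) : ⟪((1 - pairingMul h w) ^ n) g, f⟫_ℂ = ⟪g, f⟫_ℂ := by
  rw [mem_adjointKernel_iff] at hf
  have hpairing (g : H) : ⟪pairingMul h w g, f⟫_ℂ = 0 := by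
    simp only [pairingMul, sum_apply, FunLike.coe_smul, Pi.smul_apply, sum_inner,
      inner_smul_left, hf, mul_zero, Finset.sum_const_zero]
  induction n with
  | zero => rw [pow_zero, one_apply_eq_self]
  | succ n ih =>
    rw [pow_succ', mul_apply_eq_comp, sub_apply,
      one_apply_eq_self, inner_sub_left, hpairing, sub_zero, ih]

end HilbertModule

section Classical

variable {d a : ℕ}

lemma classicalKernel_eq_projectionKernel (ha : 0 < a) :
    classicalKernel d a = projectionKernel a {()} (fun _ => 0) fun _ => (⊤ : Submodule ℂ ℂ) := by
  ext z w : 1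
  rw [projectionKernel, Matrix.of_apply, Finset.sum_singleton, scalarKernel_zero ha,
    Submodule.starProjection_top']
  rfl

variable {H : Type*} [NormedAddCommGroup H] [InnerProductSpace ℂ H] [CompleteSpace H]
  [RKHS ℂ H (UnitBall d) ℂ]

lemma kerFun_origin_one_apply (hK : RKHS.kernel H = classicalKernel d a) (z : UnitBall d) :
    RKHS.kerFun H (origin d) (1 : ℂ) z = 1 := by
  simp [RKHS.kerFun_apply, hK, classicalKernel, origin]

lemma one_sub_pairingMul_pow_kerFun (hK : RKHS.kernel H = classicalKernel d a)
    (h : IsHilbertModule H) (w : UnitBall d) :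
    ((1 - pairingMul h w) ^ a) (RKHS.kerFun H w (1 : ℂ)) = RKHS.kerFun H (origin d) 1 := by
  refine RKHS.ext fun z => ?_
  have hne : 1 - ∑ k, z.1 k * conj (w.1 k) ≠ 0 := fun h0 => by
    have hlt := (norm_sum_le _ _).trans_lt (sum_norm_mul_conj_lt_one z w)
    rw [← sub_eq_zero.1 h0, norm_one] at hlt
    exact lt_irrefl _ hlt
  rw [one_sub_pairingMul_pow_apply, kerFun_origin_one_apply hK, RKHS.kerFun_apply, hK,
    classicalKernel, Matrix.of_apply, FunLike.coe_smul, Pi.smul_apply,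
    ContinuousLinearMap.id_apply, smul_smul, mul_one_div_cancel (pow_ne_zero a hne), one_smul]

lemma adjointKernel_le_span_kerFun_origin (hK : RKHS.kernel H = classicalKernel d a)
    (h : IsHilbertModule H) :
    adjointKernel h ≤ Submodule.span ℂ {RKHS.kerFun H (origin d) (1 : ℂ)} := by
  refine fun f hf => Submodule.mem_span_singleton.2 ⟨f (origin d), RKHS.ext fun w => ?_⟩
  have hconst : ⟪(1 : ℂ), f w⟫_ℂ = ⟪(1 : ℂ), f (origin d)⟫_ℂ := by
    rw [← RKHS.kerFun_inner, ← RKHS.kerFun_inner, ← one_sub_pairingMul_pow_kerFun hK h w,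
      inner_one_sub_pairingMul_pow hf]
  rw [RKHS.coe_smul, Pi.smul_apply, kerFun_origin_one_apply hK, smul_eq_mul, mul_one]
  simpa only [RCLike.inner_apply, map_one, mul_one] using hconst.symm

end Classical

namespace RootedTree

variable {V : Type*} (T : RootedTree V)

lemma reflTransGen_root_iff_of_adj {u v : V} (h : T.Adj u v) :
    Relation.ReflTransGen T.Adj T.root u ↔ Relation.ReflTransGen T.Adj T.root v := by
  refine ⟨fun hu => hu.tail h, fun hv => ?_⟩
  obtain rfl | ⟨w, hw, hwv⟩ := hv.cases_tail
  · exact absurd h (T.root_no_parent u)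
  · rwa [T.parent_unique u w v h hwv]

lemma reflTransGen_root (v : V) : Relation.ReflTransGen T.Adj T.root v := by
  have hequiv : Equivalence fun u v =>
      (Relation.ReflTransGen T.Adj T.root u ↔ Relation.ReflTransGen T.Adj T.root v) :=
    ⟨fun _ => Iff.rfl, Iff.symm, Iff.trans⟩
  exact (hequiv.eqvGen_iff.1 (Relation.EqvGen.mono (fun _ _ => T.reflTransGen_root_iff_of_adj) _ _
    (T.connected T.root v))).1 .refl

lemma depth_root : T.depth T.root = 0 :=
  Nat.sInf_eq_zero.2 (Or.inl rfl)

lemma mem_descendants_depth (v : V) : v ∈ T.descendants T.root (T.depth v) := by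
  refine Nat.sInf_mem (s := {n | v ∈ T.descendants T.root n}) ?_
  induction T.reflTransGen_root v with
  | refl => exact ⟨0, rfl⟩
  | tail _ h ih =>
    obtain ⟨n, hn⟩ := ih
    exact ⟨n + 1, _, hn, h⟩

lemma finite_descendants (v : V) (n : ℕ) : (T.descendants v n).Finite := by
  induction n with
  | zero => exact Set.finite_singleton v
  | succ n ih =>
    refine (ih.biUnion fun u _ => T.locally_finite u).subset ?_
    rintro w ⟨u, hu, hw⟩
    exact Set.mem_biUnion hu hw

variable {T}

lemma FiniteBranchingIndex.finite_setOf_isBranching (h : T.FiniteBranchingIndex) :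
    {v | T.IsBranching v}.Finite := by
  obtain ⟨N, hN⟩ := h
  refine ((Set.finite_Iic N).biUnion fun n _ => T.finite_descendants T.root n).subset ?_
  exact fun v hv => Set.mem_biUnion (hN (Set.mem_image_of_mem _ hv)) (T.mem_descendants_depth v)

lemma par_eq_of_adj {u v : V} (h : T.Adj u v) : T.par v = u :=
  T.parent_unique _ _ _ (T.adj_par ⟨u, h⟩) h

lemma adj_par_of_ne_root {v : V} (hv : v ≠ T.root) : T.Adj (T.par v) v :=
  T.adj_par (T.exists_parent hv)

lemma ne_root_of_adj {u v : V} (h : T.Adj u v) : v ≠ T.root :=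
  fun hv => T.root_no_parent u (hv ▸ h)

lemma sib_eq_children_of_adj {u v : V} (h : T.Adj u v) : T.sib v = T.children u := by
  ext w
  refine ⟨?_, fun hw => ⟨u, h, hw⟩⟩
  rintro ⟨p, hp, hw⟩
  rwa [T.parent_unique u p v h hp]

lemma par_eq_of_mem_sib {v w : V} (h : w ∈ T.sib v) : T.par w = T.par v := by
  obtain ⟨p, hv, hw⟩ := h
  rw [par_eq_of_adj hv, par_eq_of_adj hw]

lemma sib_eq_of_mem_sib {v w : V} (h : w ∈ T.sib v) : T.sib w = T.sib v := by
  obtain ⟨p, hv, hw⟩ := h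
  rw [sib_eq_children_of_adj hv, sib_eq_children_of_adj hw]

lemma ne_root_of_mem_sib {v w : V} (h : w ∈ T.sib v) : w ≠ T.root := by
  obtain ⟨p, -, hw⟩ := h
  exact ne_root_of_adj hw

lemma mem_sib_self {v : V} (hv : v ≠ T.root) : v ∈ T.sib v :=
  ⟨T.par v, adj_par_of_ne_root hv, adj_par_of_ne_root hv⟩

lemma ncard_children_pos (v : V) : 0 < (T.children v).ncard :=
  (Set.ncard_pos (T.locally_finite v)).2 (T.leafless v)

lemma children_subsingleton_of_not_isBranching {v : V} (h : ¬ T.IsBranching v) :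
    (T.children v).Subsingleton :=
  fun u hu w hw =>
    (Set.ncard_le_one (T.locally_finite v)).1 (Nat.lt_succ_iff.1 (not_le.1 h)) u hu w hw

lemma isBranching_iff_of_equiv {W : Type*} {T' : RootedTree W} (e : V ≃ W)
    (he : ∀ u v, T.Adj u v ↔ T'.Adj (e u) (e v)) (v : V) :
    T.IsBranching v ↔ T'.IsBranching (e v) := by
  have hchildren : T'.children (e v) = e '' T.children v := by
    refine Set.ext (e.surjective.forall.2 fun w => ?_)
    rw [e.injective.mem_set_image]
    exact (he v w).symm
  rw [IsBranching, IsBranching, hchildren, Set.ncard_image_of_injective _ e.injective]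

variable (T) in
/-- A chosen child of a vertex; the only one if the vertex is not branching. -/
def someChild (v : V) : V := (T.leafless v).choose

lemma adj_someChild (v : V) : T.Adj v (T.someChild v) := (T.leafless v).choose_spec

lemma someChild_injective : Function.Injective T.someChild := fun u v h =>
  T.parent_unique u v _ (adj_someChild u) (h ▸ adj_someChild v)

lemma iterate_someChild_root_injective : Function.Injective fun n => T.someChild^[n] T.root := by
  refine Function.Injective.of_lt_imp_ne fun m n hmn heq => ?_
  have hloop := Function.iterate_cancel someChild_injective heq.symm
  obtain ⟨k, hk⟩ := Nat.exists_eq_add_of_lt hmn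
  rw [hk, show m + k + 1 - m = k + 1 by omega, Function.iterate_succ_apply'] at hloop
  exact ne_root_of_adj (adj_someChild _) hloop

lemma adj_iff_eq_someChild (hT : ∀ v, ¬ T.IsBranching v) {u v : V} :
    T.Adj u v ↔ v = T.someChild u := by
  refine ⟨fun h => children_subsingleton_of_not_isBranching (hT u) h (adj_someChild u), ?_⟩
  rintro rfl
  exact adj_someChild u

lemma iterate_someChild_root_surjective (hT : ∀ v, ¬ T.IsBranching v) :
    Function.Surjective fun n => T.someChild^[n] T.root := by
  intro v
  induction T.reflTransGen_root v with
  | refl => exact ⟨0, rfl⟩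
  | tail _ h ih =>
    obtain ⟨n, rfl⟩ := ih
    exact ⟨n + 1, by rw [(adj_iff_eq_someChild hT).1 h]; exact Function.iterate_succ_apply' _ _ _⟩

theorem graphIsomorphic_rayTree_iff : GraphIsomorphic T rayTree ↔ ∀ v, ¬ T.IsBranching v := by
  refine ⟨?_, fun hT => ?_⟩
  · rintro ⟨e, he⟩ v
    rw [isBranching_iff_of_equiv e he]
    exact rayTree_not_isBranching (e v)
  · let e : ℕ ≃ V := Equiv.ofBijective (fun n => T.someChild^[n] T.root)
      ⟨iterate_someChild_root_injective, iterate_someChild_root_surjective hT⟩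
    have he (n : ℕ) : e (n + 1) = T.someChild (e n) := Function.iterate_succ_apply' _ _ _
    refine ⟨e.symm, e.surjective.forall₂.2 fun m n => ?_⟩
    rw [adj_iff_eq_someChild hT, ← he, e.injective.eq_iff, e.symm_apply_apply, e.symm_apply_apply]
    rfl

end RootedTree

section Siblings

variable {d : ℕ} {V : Fin d → Type*} {T : ∀ j, RootedTree (V j)} {F : Finset (Fin d)} {j : Fin d}
  {u v w : ∀ i, V i}

lemma eq_root_of_mem_Phi (hu : u ∈ Phi T F) (hj : j ∉ F) : u j = (T j).root :=
  not_not.1 fun h => hj ((hu j).1 h)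

lemma mem_sibF_self (hu : u ∈ Phi T F) : u ∈ sibF T F u :=
  ⟨fun j hj => RootedTree.mem_sib_self ((hu j).2 hj), fun _ _ => rfl⟩

lemma mem_Phi_of_mem_sibF (hu : u ∈ Phi T F) (hv : v ∈ sibF T F u) : v ∈ Phi T F := by
  intro j
  by_cases hj : j ∈ F
  · exact iff_of_true (RootedTree.ne_root_of_mem_sib (hv.1 j hj)) hj
  · rw [hv.2 j hj, hu j]

lemma sibF_eq_of_mem_sibF (hv : v ∈ sibF T F u) : sibF T F v = sibF T F u := by
  ext w
  refine and_congr (forall₂_congr fun j hj => ?_) (forall₂_congr fun j hj => ?_)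
  · rw [RootedTree.sib_eq_of_mem_sib (hv.1 j hj)]
  · rw [hv.2 j hj]

lemma exists_mem_Omega_mem_sibF (hu : u ∈ Phi T F) : ∃ v ∈ Omega T F, v ∈ sibF T F u := by
  have hne : (sibF T F u).Nonempty := ⟨u, mem_sibF_self hu⟩
  refine ⟨hne.some, ⟨mem_Phi_of_mem_sibF hu hne.some_mem, ?_⟩, hne.some_mem⟩
  rw [sibF_eq_of_mem_sibF hne.some_mem]
  exact fun _ => rfl

lemma sibF_empty : sibF T ∅ u = {u} := by
  ext w
  simp [sibF, funext_iff]

lemma sibF_singleton : sibF T {j} u = sibAt T j u := by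
  ext w
  simp [sibF, sibAt]

lemma sibAt_eq_of_mem_sibAt (hw : w ∈ sibAt T j v) : sibAt T j w = sibAt T j v := by
  rw [← sibF_singleton, ← sibF_singleton, sibF_eq_of_mem_sibF]
  rwa [sibF_singleton]

lemma parAt_eq_of_mem_sibAt (hw : w ∈ sibAt T j v) : parAt T j w = parAt T j v := by
  funext i
  obtain rfl | hi := eq_or_ne i j
  · simp only [parAt, Function.update_self, RootedTree.par_eq_of_mem_sib hw.1]
  · simp only [parAt, Function.update_of_ne hi, hw.2 i hi]

lemma sibAt_update_of_mem_sib {x : V j} (hx : x ∈ (T j).sib (v j)) :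
    sibAt T j (Function.update v j x) = sibAt T j v :=
  sibAt_eq_of_mem_sibAt ⟨by rwa [Function.update_self], fun _ hi => Function.update_of_ne hi _ _⟩

lemma sibAt_eq_singleton_of_not_isBranching (hv : v j ≠ (T j).root)
    (hb : ¬ (T j).IsBranching ((T j).par (v j))) : sibAt T j v = {v} := by
  refine Set.eq_singleton_iff_unique_mem.2
    ⟨⟨RootedTree.mem_sib_self hv, fun _ _ => rfl⟩, fun w hw => funext fun i => ?_⟩
  obtain rfl | hi := eq_or_ne i j
  · have hadj := RootedTree.adj_par_of_ne_root hv
    have hwv := hw.1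
    rw [RootedTree.sib_eq_children_of_adj hadj] at hwv
    exact RootedTree.children_subsingleton_of_not_isBranching hb hwv hadj
  · exact hw.2 i hi

lemma exists_mem_sibAt_ne_of_isBranching (hv : v j ≠ (T j).root)
    (hb : (T j).IsBranching ((T j).par (v j))) : ∃ w ∈ sibAt T j v, w ≠ v := by
  obtain ⟨x, hx, hne⟩ := Set.exists_ne_of_one_lt_ncard hb (v j)
  refine ⟨Function.update v j x, ⟨?_, fun _ hi => Function.update_of_ne hi _ _⟩,
    Function.update_ne_self_iff.2 hne⟩
  rwa [Function.update_self, RootedTree.sib_eq_children_of_adj (RootedTree.adj_par_of_ne_root hv)]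

lemma update_restrictTo_erase (hu : u ∈ Phi T F) (hv : v ∈ sibF T F u) (x : V j) :
    Function.update (restrictTo T (F.erase j) v) j x = Function.update v j x := by
  refine Function.update_eq_iff.2 ⟨(Function.update_self ..).symm, fun i hi => ?_⟩
  rw [Function.update_of_ne hi, restrictTo]
  split_ifs with hiF
  · rfl
  · have hiF' : i ∉ F := fun h => hiF (Finset.mem_erase.2 ⟨hi, h⟩)
    rw [hv.2 i hiF', eq_root_of_mem_Phi hu hiF']

end Siblings

section Weights

variable {d a : ℕ} {V : Fin d → Type*} {T : ∀ j, RootedTree (V j)} {j : Fin d}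

lemma weight_pos (ha : 0 < a) (w : ∀ i, V i) : 0 < weight T (cSeq a d) j w := by
  have hd : 0 < d := j.pos
  have hchildren := RootedTree.ncard_children_pos (T := T j) (parAt T j w j)
  unfold weight cSeq
  positivity

lemma weight_eq_of_mem_sibAt {c : ℕ → ℝ} {v w : ∀ i, V i} (hw : w ∈ sibAt T j v) :
    weight T c j w = weight T c j v := by
  rw [weight, weight, parAt_eq_of_mem_sibAt hw]

end Weights

section SolutionSpace

variable {d a : ℕ} {V : Fin d → Type*} {T : ∀ j, RootedTree (V j)} {F : Finset (Fin d)} {j : Fin d}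
  {u v w : ∀ i, V i}

lemma mem_jointKernel_iff {f : L2 V} :
    f ∈ jointKernel T a ↔ ∀ j g, ⟪shift T a j g, f⟫_ℂ = 0 := by
  simp only [jointKernel, Submodule.mem_iInf, LinearMap.mem_ker, ContinuousLinearMap.coe_coe,
    ← ContinuousLinearMap.adjoint_inner_right]
  exact forall_congr' fun j => ⟨fun hf g => by rw [hf, inner_zero_right],
    fun hf => ext_inner_left ℂ fun g => by rw [hf, inner_zero_right]⟩

lemma mem_solutionSpace_iff (hu : u ∈ Phi T F) {f : jointKernel T a} :
    f ∈ solutionSpace T a u F ↔ (∀ w, w ∉ sibF T F u → (f : L2 V) w = 0) ∧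
      ∀ j ∈ F, ∀ v ∈ sibF T F u, ∑ w ∈ (sibAt_finite T j v).toFinset,
        (f : L2 V) w * (weight T (cSeq a d) j w : ℂ) = 0 := by
  refine and_congr_right fun _ => forall₄_congr fun j hj v hv => ?_
  have hmem : u j ∈ (T j).sib (v j) := by
    rw [RootedTree.sib_eq_of_mem_sib (hv.1 j hj)]
    exact RootedTree.mem_sib_self ((hu j).2 hj)
  rw [Finset.sum_congr (Set.Finite.toFinset_inj.2 _) fun _ _ => rfl]
  rw [update_restrictTo_erase hu hv, sibAt_update_of_mem_sib hmem]

lemma apply_root_eq_zero_of_mem_solutionSpace {f : jointKernel T a}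
    (hf : f ∈ solutionSpace T a u F) (hj : j ∈ F) : (f : L2 V) (fun i => (T i).root) = 0 :=
  hf.1 _ fun h => RootedTree.ne_root_of_mem_sib (h.1 j hj) rfl

lemma isBranching_par_of_solutionSpace_ne_bot (ha : 0 < a) (hu : u ∈ Phi T F)
    (hL : solutionSpace T a u F ≠ ⊥) (hj : j ∈ F) : (T j).IsBranching ((T j).par (u j)) := by
  contrapose! hL
  refine (Submodule.eq_bot_iff _).2 fun f hf => Subtype.ext (lp.ext (funext fun v => ?_))
  obtain ⟨hsupp, hsum⟩ := (mem_solutionSpace_iff hu).1 hf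
  by_cases hv : v ∈ sibF T F u
  · have hsib : sibAt T j v = {v} := by
      refine sibAt_eq_singleton_of_not_isBranching (RootedTree.ne_root_of_mem_sib (hv.1 j hj)) ?_
      rwa [RootedTree.par_eq_of_mem_sib (hv.1 j hj)]
    have hweight : (weight T (cSeq a d) j v : ℂ) ≠ 0 :=
      Complex.ofReal_ne_zero.2 (weight_pos ha v).ne'
    have hterm := hsum j hj v hv
    simp only [hsib, Set.toFinite_toFinset, Set.toFinset_singleton, Finset.sum_singleton] at hterm
    exact (mul_eq_zero.1 hterm).resolve_right hweight
  · exact hsupp v hv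

open Classical in
lemma single_sub_single_mem_jointKernel (hv : v ∈ Phi T {j}) (hw : w ∈ sibAt T j v) :
    (lp.single 2 v 1 - lp.single 2 w 1 : L2 V) ∈ jointKernel T a := by
  refine mem_jointKernel_iff.2 fun i g => ?_
  rw [inner_sub_right, lp.inner_single_right, lp.inner_single_right, sub_eq_zero]
  change ⟪shiftFun T a i g v, (1 : ℂ)⟫_ℂ = ⟪shiftFun T a i g w, (1 : ℂ)⟫_ℂ
  congr 1
  obtain rfl | hi := eq_or_ne i j
  · rw [shiftFun, shiftFun, if_neg ((hv i).2 (Finset.mem_singleton_self i)),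
      if_neg (RootedTree.ne_root_of_mem_sib hw.1), weight_eq_of_mem_sibAt hw,
      parAt_eq_of_mem_sibAt hw]
  · have hroot : v i = (T i).root := eq_root_of_mem_Phi hv (Finset.notMem_singleton.2 hi)
    rw [shiftFun, shiftFun, if_pos hroot, if_pos (by rw [hw.2 i hi, hroot])]

open Classical in
lemma single_sub_single_mem_solutionSpace (hv : v ∈ Phi T {j}) (hw : w ∈ sibAt T j v) :
    ⟨_, single_sub_single_mem_jointKernel hv hw⟩ ∈ solutionSpace T a v {j} := by
  have hvv : v ∈ sibAt T j v := sibF_singleton.subset (mem_sibF_self hv)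
  refine (mem_solutionSpace_iff hv).2 ⟨fun x hx => ?_, fun i hi x hx => ?_⟩
  · rw [sibF_singleton] at hx
    have hxv : x ≠ v := ne_of_mem_of_not_mem hvv hx |>.symm
    have hxw : x ≠ w := ne_of_mem_of_not_mem hw hx |>.symm
    simp [hxv, hxw]
  · obtain rfl := Finset.mem_singleton.1 hi
    rw [sibF_singleton] at hx
    simp [sub_mul, Finset.sum_sub_distrib, Pi.single_apply, sibAt_eq_of_mem_sibAt hx, hvv, hw,
      weight_eq_of_mem_sibAt hw]

lemma solutionSpace_singleton_ne_bot (hv : v ∈ Phi T {j})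
    (hb : (T j).IsBranching ((T j).par (v j))) : solutionSpace T a v {j} ≠ ⊥ := by
  classical
  obtain ⟨w, hw, hne⟩ :=
    exists_mem_sibAt_ne_of_isBranching ((hv j).2 (Finset.mem_singleton_self j)) hb
  refine (Submodule.ne_bot_iff _).2 ⟨_, single_sub_single_mem_solutionSpace hv hw, fun h => ?_⟩
  have happly := congrArg (fun f : jointKernel T a => (f : L2 V) v) h
  simp [hne.symm] at happly

lemma exists_mem_Omega_solutionSpace_ne_bot {p : V j} (hp : (T j).IsBranching p) :
    ∃ u ∈ Omega T {j}, solutionSpace T a u {j} ≠ ⊥ := by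
  obtain ⟨c, hc⟩ := (T j).leafless p
  have hmem : Function.update (fun i => (T i).root) j c ∈ Phi T {j} := by
    intro i
    obtain rfl | hi := eq_or_ne i j
    · simpa using RootedTree.ne_root_of_adj hc
    · simp [hi]
  obtain ⟨u, hu, hsib⟩ := exists_mem_Omega_mem_sibF hmem
  refine ⟨u, hu, solutionSpace_singleton_ne_bot hu.1 ?_⟩
  rw [RootedTree.par_eq_of_mem_sib (hsib.1 j (Finset.mem_singleton_self j)), Function.update_self,
    RootedTree.par_eq_of_adj hc]
  exact hp

end SolutionSpace

section RootElement

variable {d : ℕ} {V : Fin d → Type*} {T : ∀ j, RootedTree (V j)} {a : ℕ}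

variable (T) in
/-- The root of the product. -/
def rootVec : ∀ j, V j := fun j => (T j).root

lemma mdepth_rootVec : mdepth T (rootVec T) = 0 :=
  funext fun j => (T j).depth_root

lemma mem_Omega_empty_iff {u : ∀ i, V i} : u ∈ Omega T ∅ ↔ u = rootVec T := by
  refine ⟨fun h => funext fun j => eq_root_of_mem_Phi h.1 (Finset.notMem_empty j), ?_⟩
  rintro rfl
  exact ⟨fun j => by simp [rootVec], fun h => sibF_empty.subset h.some_mem⟩

open Classical in
variable (T a) in
/-- The basis vector at the root, as an element of the joint kernel. -/
def rootElement : jointKernel T a :=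
  ⟨lp.single 2 (rootVec T) 1, mem_jointKernel_iff.2 fun j g => by
    rw [lp.inner_single_right]
    change ⟪shiftFun T a j g (rootVec T), (1 : ℂ)⟫_ℂ = 0
    rw [shiftFun, if_pos (by rfl), inner_zero_left]⟩

lemma inner_rootElement (f : jointKernel T a) :
    ⟪rootElement T a, f⟫_ℂ = (f : L2 V) (rootVec T) := by
  classical
  rw [Submodule.coe_inner, rootElement, lp.inner_single_left, RCLike.inner_apply, map_one, mul_one]

lemma norm_rootElement : ‖rootElement T a‖ = 1 := by
  classical
  rw [rootElement, Submodule.coe_norm, lp.norm_single (by norm_num), norm_one]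

lemma solutionSpace_rootVec_eq_span :
    solutionSpace T a (rootVec T) ∅ = Submodule.span ℂ {rootElement T a} := by
  classical
  refine le_antisymm (fun f hf => ?_) ?_
  · refine Submodule.mem_span_singleton.2 ⟨(f : L2 V) (rootVec T), ?_⟩
    ext w
    obtain rfl | hw := eq_or_ne w (rootVec T)
    · simp [rootElement]
    · simp [rootElement, hw, hf.1 w (by rwa [sibF_empty])]
  · refine (Submodule.span_singleton_le_iff_mem _ _).2 ⟨fun w hw => ?_, by simp⟩
    rw [sibF_empty, Set.mem_singleton_iff] at hw
    simp [rootElement, hw]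

lemma isOrtho_solutionSpace_rootVec {F : Finset (Fin d)} {j : Fin d} (hj : j ∈ F) (u : ∀ i, V i) :
    solutionSpace T a (rootVec T) ∅ ⟂ solutionSpace T a u F := by
  simp only [solutionSpace_rootVec_eq_span, Submodule.isOrtho_iff_inner_eq,
    Submodule.mem_span_singleton]
  rintro _ ⟨c, rfl⟩ f hf
  have hroot : (f : L2 V) (rootVec T) = 0 := apply_root_eq_zero_of_mem_solutionSpace hf hj
  rw [inner_smul_left, inner_rootElement, hroot, mul_zero]

end RootElement

section TreeKernel

variable {d : ℕ} {V : Fin d → Type*} {T : ∀ j, RootedTree (V j)} {a : ℕ}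

variable (T a) in
/-- The pairs `(F, u)` with `u ∈ Ω_F` that contribute to the kernel of `H_{c_a}(T)`. -/
def activePairs : Set (Finset (Fin d) × ∀ i, V i) :=
  {p | p.2 ∈ Omega T p.1 ∧ solutionSpace T a p.2 p.1 ≠ ⊥}

lemma rootVec_mem_activePairs : (∅, rootVec T) ∈ activePairs T a := by
  refine ⟨mem_Omega_empty_iff.2 rfl, ?_⟩
  rw [solutionSpace_rootVec_eq_span, Ne, Submodule.span_singleton_eq_bot, ← norm_eq_zero,
    norm_rootElement]
  exact one_ne_zero

lemma finite_activePairs (ha : 0 < a) (hT : ∀ j, (T j).FiniteBranchingIndex) :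
    (activePairs T a).Finite := by
  have hcoord (j : Fin d) : ({(T j).root} ∪
      ⋃ p ∈ {p | (T j).IsBranching p}, (T j).children p).Finite :=
    (Set.finite_singleton _).union
      ((hT j).finite_setOf_isBranching.biUnion fun p _ => (T j).locally_finite p)
  refine (Set.finite_univ.prod (Set.Finite.pi' hcoord)).subset ?_
  rintro ⟨F, u⟩ ⟨hu, hL⟩
  refine ⟨trivial, fun j => ?_⟩
  by_cases hj : j ∈ F
  · exact Or.inr (Set.mem_biUnion (isBranching_par_of_solutionSpace_ne_bot ha hu.1 hL hj)
      (RootedTree.adj_par_of_ne_root ((hu.1 j).2 hj)))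
  · exact Or.inl (eq_root_of_mem_Phi hu.1 hj)

lemma activePairs_eq_singleton (ha : 0 < a) (hb : ∀ j p, ¬ (T j).IsBranching p) :
    activePairs T a = {(∅, rootVec T)} := by
  refine Set.eq_singleton_iff_unique_mem.2 ⟨rootVec_mem_activePairs, ?_⟩
  rintro ⟨F, u⟩ ⟨hu, hL⟩
  obtain rfl | ⟨j, hj⟩ := F.eq_empty_or_nonempty
  · exact congrArg (Prod.mk ∅) (mem_Omega_empty_iff.1 hu)
  · exact absurd (isBranching_par_of_solutionSpace_ne_bot ha hu.1 hL hj) (hb _ _)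

lemma treeKernel_eq_projectionKernel (hfin : (activePairs T a).Finite) :
    treeKernel T a = projectionKernel a hfin.toFinset (fun p => mdepth T p.2)
      fun p => solutionSpace T a p.2 p.1 := by
  classical
  ext z w : 1
  have hslice (F : Finset (Fin d)) : {u | (F, u) ∈ activePairs T a}.Finite :=
    hfin.preimage (Prod.mk_right_injective F).injOn
  rw [treeKernel, projectionKernel, Matrix.of_apply, Matrix.of_apply,
    Finset.sum_finset_product _ Finset.univ fun F => (hslice F).toFinset]
  · refine Finset.sum_congr rfl fun F _ => finsum_mem_eq_sum_of_inter_support_eq _ ?_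
    have hne {u : ∀ i, V i} (hu : scalarKernel a (mdepth T u) z w •
        (solutionSpace T a u F).starProjection ≠ 0) : solutionSpace T a u F ≠ ⊥ :=
      fun h => hu (by simp [h])
    ext u
    rw [Set.Finite.coe_toFinset]
    exact and_congr_left fun hu => (and_iff_left (hne hu)).symm
  · simp

end TreeKernel

section AdjointKernel

variable {d a : ℕ} {ι E : Type*} [NormedAddCommGroup E] [InnerProductSpace ℂ E] [CompleteSpace E]
variable {s : Finset ι} {β : ι → Fin d → ℕ} {L : ι → Submodule ℂ E}
  [∀ i, (L i).HasOrthogonalProjection]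
variable {H : Type*} [NormedAddCommGroup H] [InnerProductSpace ℂ H] [CompleteSpace H]
  [RKHS ℂ H (UnitBall d) E]

lemma eq_zero_of_kerFun_origin_eq_zero (hK : RKHS.kernel H = projectionKernel a s β L) {i : ι}
    (hi : i ∈ s) {η : E} (hη : η ∈ L i) (h0 : RKHS.kerFun H (origin d) η = 0) : η = 0 := by
  rw [← Submodule.starProjection_eq_self_iff.2 hη,
    starProjection_eq_zero_of_kerFun_origin_eq_zero hK hi h0]

lemma eq_bot_of_adjointKernel_le_span (hK : RKHS.kernel H = projectionKernel a s β L)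
    {h : IsHilbertModule H} {c : H} (hc : adjointKernel h ≤ Submodule.span ℂ {c}) {i j : ι}
    (hi : i ∈ s) (hj : j ∈ s) (hortho : L i ⟂ L j) (hLi : L i ≠ ⊥) : L j = ⊥ := by
  refine (Submodule.eq_bot_iff _).2 fun η hη => ?_
  obtain ⟨ξ, hξ, hξ0⟩ := Submodule.exists_mem_ne_zero_of_ne_bot hLi
  obtain ⟨x, hx⟩ := Submodule.mem_span_singleton.1 (hc (kerFun_origin_mem_adjointKernel h ξ))
  obtain ⟨y, hy⟩ := Submodule.mem_span_singleton.1 (hc (kerFun_origin_mem_adjointKernel h η))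
  have hcomb : RKHS.kerFun H (origin d) (y • ξ - x • η) = 0 := by
    rw [map_sub, map_smul, map_smul, ← hx, ← hy, smul_comm, sub_self]
  have hproj := starProjection_eq_zero_of_kerFun_origin_eq_zero hK hi hcomb
  rw [map_sub, map_smul, map_smul, Submodule.starProjection_eq_self_iff.2 hξ,
    (L i).starProjection_apply_eq_zero_iff.2 (hortho.symm hη), smul_zero, sub_zero] at hproj
  refine eq_zero_of_kerFun_origin_eq_zero hK hj hη ?_
  rw [← hy, (smul_eq_zero.1 hproj).resolve_right hξ0, zero_smul]

end AdjointKernel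

section ScalarModule

variable {d a : ℕ} {E : Type*} [NormedAddCommGroup E] [InnerProductSpace ℂ E]
variable {H : Type*} [NormedAddCommGroup H] [InnerProductSpace ℂ H] [CompleteSpace H]
  [RKHS ℂ H (UnitBall d) E]
variable {H' : Type*} [NormedAddCommGroup H'] [InnerProductSpace ℂ H'] [CompleteSpace H']
  [RKHS ℂ H' (UnitBall d) ℂ] {h : IsHilbertModule H} {h' : IsHilbertModule H'}

lemma adjointKernel_le_span_of_hilbertModulesIsomorphic
    (hK' : RKHS.kernel H' = classicalKernel d a) (hiso : HilbertModulesIsomorphic h h') :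
    ∃ c, adjointKernel h ≤ Submodule.span ℂ {c} := by
  obtain ⟨U, hU⟩ := hiso
  refine ⟨U.symm (RKHS.kerFun H' (origin d) 1), fun f hf => Submodule.mem_span_singleton.2 ?_⟩
  obtain ⟨x, hx⟩ := Submodule.mem_span_singleton.1
    (adjointKernel_le_span_kerFun_origin hK' h' (map_mem_adjointKernel hU hf))
  exact ⟨x, by rw [← map_smul, hx, U.symm_apply_apply]⟩

lemma hilbertModulesIsomorphic_of_kernel_eq [CompleteSpace E] {k : UnitBall d → UnitBall d → ℂ}
    {e : E} (he : ‖e‖ = 1)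
    (hK : ∀ z w, RKHS.kernel H z w = k z w • (Submodule.span ℂ {e}).starProjection)
    (hK' : ∀ z w, RKHS.kernel H' z w = k z w • ContinuousLinearMap.id ℂ ℂ) :
    HilbertModulesIsomorphic h h' := by
  have hsurj : Function.Surjective (innerSL ℂ e) := fun c =>
    ⟨c • e, by rw [map_smul, innerSL_apply_apply, inner_self_eq_one_of_norm_eq_one he, smul_eq_mul,
      mul_one]⟩
  obtain ⟨U, hU⟩ := exists_linearIsometryEquiv_of_kernel_eq H H' _ hsurj fun z w v v' => by
    simp only [hK, hK', FunLike.coe_smul, Pi.smul_apply, ContinuousLinearMap.id_apply,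
      Submodule.starProjection_unit_singleton ℂ he, innerSL_apply_apply, inner_smul_left,
      RCLike.inner_apply, smul_eq_mul, map_mul]
    ring
  refine ⟨U, fun k f => RKHS.ext fun z => ext_inner_left ℂ fun c => ?_⟩
  obtain ⟨v, rfl⟩ := hsurj c
  rw [hU, coordMul_apply, coordMul_apply, inner_smul_right, inner_smul_right, hU]

end ScalarModule

section Isomorphism

variable {d : ℕ} {V : Fin d → Type*} {T : ∀ j, RootedTree (V j)} {a : ℕ}

lemma posSemidef_treeKernel (ha : 0 < a) (hT : ∀ j, (T j).FiniteBranchingIndex) :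
    (treeKernel T a).PosSemidef := by
  rw [treeKernel_eq_projectionKernel (finite_activePairs ha hT)]
  exact posSemidef_projectionKernel ha

lemma posSemidef_classicalKernel (ha : 0 < a) : (classicalKernel d a).PosSemidef := by
  rw [classicalKernel_eq_projectionKernel ha]
  exact posSemidef_projectionKernel ha

lemma treeKernel_apply_of_not_isBranching (ha : 0 < a) (hb : ∀ j p, ¬ (T j).IsBranching p)
    (z w : UnitBall d) :
    treeKernel T a z w =
      scalarKernel a 0 z w • (Submodule.span ℂ {rootElement T a}).starProjection := by
  have hpairs := activePairs_eq_singleton ha hb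
  have hfin : (activePairs T a).Finite := hpairs ▸ Set.finite_singleton _
  have hset : hfin.toFinset = {(∅, rootVec T)} := by
    simp only [hpairs, Set.toFinite_toFinset, Set.toFinset_singleton]
  rw [treeKernel_eq_projectionKernel hfin, projectionKernel, Matrix.of_apply, hset,
    Finset.sum_singleton, mdepth_rootVec]
  simp only [solutionSpace_rootVec_eq_span]

variable {H : Type*} [NormedAddCommGroup H] [InnerProductSpace ℂ H] [CompleteSpace H]
  [RKHS ℂ H (UnitBall d) (jointKernel T a)]
variable {H' : Type*} [NormedAddCommGroup H'] [InnerProductSpace ℂ H'] [CompleteSpace H']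
  [RKHS ℂ H' (UnitBall d) ℂ] {h : IsHilbertModule H} {h' : IsHilbertModule H'}

lemma not_isBranching_of_hilbertModulesIsomorphic (ha : 0 < a)
    (hT : ∀ j, (T j).FiniteBranchingIndex) (hK : RKHS.kernel H = treeKernel T a)
    (hK' : RKHS.kernel H' = classicalKernel d a) (hiso : HilbertModulesIsomorphic h h')
    (j : Fin d) (p : V j) : ¬ (T j).IsBranching p := by
  intro hp
  obtain ⟨u, hu, hL⟩ := exists_mem_Omega_solutionSpace_ne_bot (a := a) hp
  obtain ⟨c, hc⟩ := adjointKernel_le_span_of_hilbertModulesIsomorphic hK' hiso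
  have hfin : (activePairs T a).Finite := finite_activePairs ha hT
  have hroot : (∅, rootVec T) ∈ hfin.toFinset := hfin.mem_toFinset.2 rootVec_mem_activePairs
  have hbranch : ({j}, u) ∈ hfin.toFinset := hfin.mem_toFinset.2 ⟨hu, hL⟩
  exact hL (eq_bot_of_adjointKernel_le_span (hK.trans (treeKernel_eq_projectionKernel hfin)) hc
    hroot hbranch (isOrtho_solutionSpace_rootVec (Finset.mem_singleton_self j) u)
    rootVec_mem_activePairs.2)

lemma hilbertModulesIsomorphic_of_not_isBranching (ha : 0 < a)
    (hK : RKHS.kernel H = treeKernel T a) (hK' : RKHS.kernel H' = classicalKernel d a)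
    (hb : ∀ j p, ¬ (T j).IsBranching p) : HilbertModulesIsomorphic h h' :=
  hilbertModulesIsomorphic_of_kernel_eq norm_rootElement
    (fun z w => by rw [hK, treeKernel_apply_of_not_isBranching ha hb]) fun z w => by
      rw [hK', classicalKernel, Matrix.of_apply, scalarKernel_zero ha]

end Isomorphism

end TreeModule

end

theorem corollary1p6 {a d : ℕ} (ha : 0 < a) (hd : 0 < d) {V : Fin d → Type*}
    (T : ∀ j, TreeModule.RootedTree (V j)) (hT : ∀ j, (T j).FiniteBranchingIndex) :
    ∃ (_ : Fact (TreeModule.treeKernel T a).PosSemidef)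
      (_ : Fact (TreeModule.classicalKernel d a).PosSemidef)
      (h₁ : TreeModule.IsHilbertModule (TreeModule.TreeSpace T a))
      (h₂ : TreeModule.IsHilbertModule (TreeModule.ClassicalSpace d a)),
      TreeModule.HilbertModulesIsomorphic h₁ h₂ ↔
        ∀ j, TreeModule.GraphIsomorphic (T j) TreeModule.rayTree := by
  open TreeModule in
  have i₁ : Fact (treeKernel T a).PosSemidef := ⟨posSemidef_treeKernel ha hT⟩
  have i₂ : Fact (classicalKernel d a).PosSemidef := ⟨posSemidef_classicalKernel ha⟩
  have hK₁ : RKHS.kernel (TreeSpace T a) = treeKernel T a := RKHS.OfKernel.kernel_ofKernel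
  have hK₂ : RKHS.kernel (ClassicalSpace d a) = classicalKernel d a :=
    RKHS.OfKernel.kernel_ofKernel
  have h₁ : IsHilbertModule (TreeSpace T a) := isHilbertModule_of_kernel_eq ha
    (hK₁.trans (treeKernel_eq_projectionKernel (finite_activePairs ha hT)))
  have h₂ : IsHilbertModule (ClassicalSpace d a) := isHilbertModule_of_kernel_eq ha
    (hK₂.trans (classicalKernel_eq_projectionKernel ha))
  refine ⟨i₁, i₂, h₁, h₂, ?_⟩
  simp only [RootedTree.graphIsomorphic_rayTree_iff]
  exact ⟨not_isBranching_of_hilbertModulesIsomorphic ha hT hK₁ hK₂,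
    hilbertModulesIsomorphic_of_not_isBranching ha hK₁ hK₂⟩
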